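/- Let $d,m\ge 1$ be integers, $\mathbb T=\mathbb R/2\pi\mathbb Z$, $\sigma\in(0,1)$, and $0<\alpha<2_\sigma^*$, where $2_\sigma^*=\frac{4\sigma}{d+m-2\sigma}$ if $d+m>2\sigma$ and $2_\sigma^*=\infty$ if $d+m\le 2\sigma$. Let $(-\Delta)^{\sigma/2}$ be the operator on $L^2(\mathbb R^d\times\mathbb T^m)$ (complex-valued functions) with Fourier multiplier $(|\xi|^2+|k|^2)^{\sigma/2}$, $(\xi,k)\in\mathbb R^d\times\mathbb Z^m$, and let $H^\sigma$ be its domain $\{u\in L^2:(-\Delta)^{\sigma/2}u\in L^2\}$. For $\omega>0$ and $u\in H^\sigma$ put $$\mathcal A_\omega(u)=\tfrac12\|(-\Delta)^{\sigma/2}u\|_2^2+\tfrac\omega2\|u\|_2^2-\tfrac1{\alpha+2}\|u\|_{\alpha+2}^{\alpha+2},\qquad \mathcal B_\omega(u)=\langle\mathcal A_\omega'(u),u\rangle,\qquad \mathcal I_\omega=\mathcal A_\omega-\tfrac1{\alpha+2}\mathcal B_\omega,$$ $$c_\omega=\inf\{\mathcal A_\omega(u):u\in H^\sigma\setminus\{0\},\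 \mathcal B_\omega(u)=0\}.$$ A ground state of $$(-\Delta)^\sigma\varphi+\omega\varphi=|\varphi|^\alpha\varphi\quad\text{on }\mathbb R^d\times\mathbb T^m\qquad(\ast)$$ is a nontrivial weak solution $\varphi\in H^\sigma$ of $(\ast)$ (tested against all $v\in H^\sigma$) whose action $\mathcal A_\omega(\varphi)$ is least among all nontrivial weak solutions of $(\ast)$ in $H^\sigma$. Then for every $\omega>0$ the set defining $c_\omega$ is non-empty, $\mathcal A_\omega$ is bounded below on it, and there is $\varphi\in H^\sigma\setminus\{0\}$ with $\mathcal B_\omega(\varphi)=0$ and $\mathcal A_\omega(\varphi)=c_\omega$ that is a ground state of $(\ast)$. Moreover $$c_\omega=\inf\{\mathcal I_\omega(u):u\in H^\sigma\setminus\{0\},\ \mathcal B_\omega(u)\le 0\}.$$ Furthermore, the map $\omega\mapsto c_\omega$ is continuous and strictly increasing on $(0,\infty)$. -/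

import Mathlib

open MeasureTheory Set
open scoped FourierTransform ENNReal InnerProductSpace

noncomputable section

namespace Waveguide

instance instFactTwoPiPos : Fact ((0 : ℝ) < 2 * Real.pi) := ⟨Real.two_pi_pos⟩

/-- The waveguide manifold `ℝ^d × 𝕋^m` with `𝕋 = ℝ / 2πℤ`. Its `volume` is the product of Lebesgue
measure on `ℝ^d` and of `m` copies of the measure of total mass `2π` on `𝕋`. -/
abbrev Domain (d m : ℕ) : Type :=
  EuclideanSpace ℝ (Fin d) × (Fin m → AddCircle (2 * Real.pi))

/-- The complex Hilbert space `L²(ℝ^d × 𝕋^m)`. -/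
abbrev L2 (d m : ℕ) : Type :=
  Lp ℂ 2 (volume : Measure (Domain d m))

/-- The character `y ↦ exp(i k · y)` of `𝕋^m`. -/
def torusChar {m : ℕ} (k : Fin m → ℤ) (y : Fin m → AddCircle (2 * Real.pi)) : ℂ :=
  ∏ i, fourier (k i) (y i)

/-- The `k`-th Fourier coefficient of `u` in the torus variable,
`u_k(x) = (2π)^{-m} ∫_{𝕋^m} exp(-i k · y) u(x, y) dy`. -/
def torusCoeff {d m : ℕ} (u : L2 d m) (k : Fin m → ℤ) (x : EuclideanSpace ℝ (Fin d)) : ℂ :=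
  (((2 * Real.pi) ^ m : ℝ) : ℂ)⁻¹ * ∫ y, (starRingEnd ℂ) (torusChar k y) * u (x, y)

theorem norm_torusChar {m : ℕ} (k : Fin m → ℤ) (y : Fin m → AddCircle (2 * Real.pi)) :
    ‖torusChar k y‖ = 1 := by
  simp [torusChar, norm_prod, fourier_apply, Circle.norm_coe]

theorem continuous_torusChar {m : ℕ} (k : Fin m → ℤ) : Continuous (torusChar k) := by
  unfold torusChar
  fun_prop

theorem memLp_torusCoeff {d m : ℕ} (u : L2 d m) (k : Fin m → ℤ) :
    MemLp (torusCoeff u k) 2 volume := by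
  unfold torusCoeff
  refine MemLp.const_mul ?_ _
  have hu : MemLp (fun p : Domain d m => (starRingEnd ℂ) (torusChar k p.2) * u p) 2 volume := by
    refine (Lp.memLp u).of_le ?_ ?_
    · refine AEStronglyMeasurable.mul ?_ (Lp.aestronglyMeasurable u)
      exact (Complex.continuous_conj.comp
        ((continuous_torusChar k).comp continuous_snd)).aestronglyMeasurable
    · exact Filter.Eventually.of_forall fun p => by simp [norm_torusChar]
  set F : Domain d m → ℂ := fun p => (starRingEnd ℂ) (torusChar k p.2) * u p with hF
  have hFm : AEStronglyMeasurable F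
      ((volume : Measure (EuclideanSpace ℝ (Fin d))).prod volume) := hu.1
  have hmeas : AEStronglyMeasurable (fun x => ∫ y, F (x, y))
      (volume : Measure (EuclideanSpace ℝ (Fin d))) := hFm.integral_prod_right'
  refine ⟨hmeas, ?_⟩
  have h2 := hu.2
  rw [eLpNorm_lt_top_iff_lintegral_rpow_enorm_lt_top (by norm_num) (by norm_num)] at h2 ⊢
  have hpos : (0 : ℝ) < ENNReal.toReal 2 := by norm_num
  set C : ℝ≥0∞ := (volume : Measure (Fin m → AddCircle (2 * Real.pi))) univ
  have hC : C < ∞ := measure_lt_top _ _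
  have key : ∀ᵐ x ∂(volume : Measure (EuclideanSpace ℝ (Fin d))),
      ‖∫ y, F (x, y)‖ₑ ^ ENNReal.toReal 2 ≤
        C * ∫⁻ y, ‖F (x, y)‖ₑ ^ ENNReal.toReal 2 := by
    filter_upwards [hFm.prodMk_left] with x hx
    have h1 : ‖∫ y, F (x, y)‖ₑ ≤ eLpNorm (fun y => F (x, y)) 1 volume := by
      rw [eLpNorm_one_eq_lintegral_enorm]
      exact enorm_integral_le_lintegral_enorm _
    have h3 := eLpNorm_le_eLpNorm_mul_rpow_measure_univ (p := 1) (q := 2) (by norm_num) hx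
    have h4 := ENNReal.rpow_le_rpow (h1.trans h3) hpos.le
    refine h4.trans (le_of_eq ?_)
    rw [ENNReal.mul_rpow_of_nonneg _ _ hpos.le,
      eLpNorm_eq_lintegral_rpow_enorm_toReal (by norm_num) (by norm_num),
      ← ENNReal.rpow_mul, ← ENNReal.rpow_mul, mul_comm]
    norm_num
    rfl
  calc ∫⁻ x, ‖∫ y, F (x, y)‖ₑ ^ ENNReal.toReal 2
      ≤ ∫⁻ x, C * ∫⁻ y, ‖F (x, y)‖ₑ ^ ENNReal.toReal 2 := lintegral_mono_ae key
    _ = C * ∫⁻ x, ∫⁻ y, ‖F (x, y)‖ₑ ^ ENNReal.toReal 2 := lintegral_const_mul' _ _ hC.ne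
    _ = C * ∫⁻ p, ‖F p‖ₑ ^ ENNReal.toReal 2 := by
        congr 1
        exact (lintegral_prod (μ := (volume : Measure (EuclideanSpace ℝ (Fin d))))
          (ν := (volume : Measure (Fin m → AddCircle (2 * Real.pi)))) _
          (hFm.enorm.pow_const _)).symm
    _ < ∞ := ENNReal.mul_lt_top hC h2

/-- The Fourier transform on `ℝ^d × 𝕋^m`: for each frequency `k ∈ ℤ^m` of the torus variable, the
`L²` Fourier transform on `ℝ^d`, with kernel `exp(-2πi x · ξ)`, of the `k`-th coefficient. -/
def fourierMode {d m : ℕ} (u : L2 d m) (k : Fin m → ℤ) :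
    Lp ℂ 2 (volume : Measure (EuclideanSpace ℝ (Fin d))) :=
  𝓕 ((memLp_torusCoeff u k).toLp (torusCoeff u k))

/-- The symbol `|2πξ|² + |k|²` of `-Δ` on `ℝ^d × 𝕋^m`. The factor `2π` comes from the kernel
`exp(-2πi x · ξ)` of the Fourier transform. -/
def laplaceSymbol {d m : ℕ} (ξ : EuclideanSpace ℝ (Fin d)) (k : Fin m → ℤ) : ℝ :=
  (2 * Real.pi * ‖ξ‖) ^ 2 + ∑ i, (k i : ℝ) ^ 2

/-- `w = (-Δ)^s u` in `L²`: `ŵ(ξ, k) = (|2πξ|² + |k|²)^s û(ξ, k)`. -/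
def IsFracLaplacian {d m : ℕ} (s : ℝ) (u w : L2 d m) : Prop :=
  ∀ k : Fin m → ℤ, ∀ᵐ ξ : EuclideanSpace ℝ (Fin d),
    fourierMode w k ξ = ((laplaceSymbol ξ k ^ s : ℝ) : ℂ) * fourierMode u k ξ

/-- The Sobolev space `H^σ(ℝ^d × 𝕋^m)`: all `u ∈ L²` with `(-Δ)^{σ/2} u ∈ L²`. -/
def Sobolev (d m : ℕ) (σ : ℝ) : Set (L2 d m) :=
  {u | ∃ w : L2 d m, IsFracLaplacian (σ / 2) u w}

open Classical in
/-- `(-Δ)^{s} u ∈ L²`, for `u` in the `L²` domain of `(-Δ)^s` (and `0` outside this domain). -/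
def fracLaplacian {d m : ℕ} (s : ℝ) (u : L2 d m) : L2 d m :=
  if h : ∃ w : L2 d m, IsFracLaplacian s u w then h.choose else 0

/-- The critical exponent `2_σ^*`, with value in the extended reals. -/
def criticalExponent (d m : ℕ) (σ : ℝ) : EReal :=
  if 2 * σ < (d : ℝ) + m then ((4 * σ / ((d : ℝ) + m - 2 * σ) : ℝ) : EReal) else ⊤

/-- The action `𝒜_ω(u) = ½‖(-Δ)^{σ/2}u‖₂² + (ω/2)‖u‖₂² - (1/(α+2))‖u‖_{α+2}^{α+2}`. -/
def action {d m : ℕ} (σ α ω : ℝ) (u : L2 d m) : ℝ :=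
  1 / 2 * ‖fracLaplacian (σ / 2) u‖ ^ 2 + ω / 2 * ‖u‖ ^ 2
    - 1 / (α + 2) * ∫ z, ‖u z‖ ^ (α + 2)

/-- The derivative `⟨𝒜_ω'(u), v⟩` of the action at `u` in the direction `v`. -/
def actionDeriv {d m : ℕ} (σ α ω : ℝ) (u v : L2 d m) : ℝ :=
  deriv (fun t : ℝ => action σ α ω (u + (t : ℂ) • v)) 0

/-- The Nehari functional `ℬ_ω(u) = ⟨𝒜_ω'(u), u⟩`. -/
def nehari {d m : ℕ} (σ α ω : ℝ) (u : L2 d m) : ℝ :=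
  actionDeriv σ α ω u u

/-- `ℐ_ω = 𝒜_ω - ℬ_ω / (α + 2)`. -/
def reducedAction {d m : ℕ} (σ α ω : ℝ) (u : L2 d m) : ℝ :=
  action σ α ω u - 1 / (α + 2) * nehari σ α ω u

/-- The Nehari manifold `{u ∈ H^σ \ {0} : ℬ_ω(u) = 0}`. -/
def nehariManifold (d m : ℕ) (σ α ω : ℝ) : Set (L2 d m) :=
  {u | u ∈ Sobolev d m σ ∧ u ≠ 0 ∧ nehari σ α ω u = 0}

/-- `c_ω = inf {𝒜_ω(u) : u ∈ H^σ \ {0}, ℬ_ω(u) = 0}`. -/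
def groundLevel (d m : ℕ) (σ α ω : ℝ) : ℝ :=
  sInf (action σ α ω '' nehariManifold d m σ α ω)

/-- `φ ∈ H^σ` is a weak solution of `(-Δ)^σ φ + ω φ = |φ|^α φ` on `ℝ^d × 𝕋^m`: for all `v ∈ H^σ`,
`∫ (-Δ)^{σ/2}φ conj((-Δ)^{σ/2}v) + ω ∫ φ conj(v) = ∫ |φ|^α φ conj(v)`. -/
def IsWeakSolution {d m : ℕ} (σ α ω : ℝ) (φ : L2 d m) : Prop :=
  φ ∈ Sobolev d m σ ∧ ∀ v ∈ Sobolev d m σ,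
    Integrable (fun z => ((‖φ z‖ ^ α : ℝ) : ℂ) * φ z * (starRingEnd ℂ) (v z)) ∧
    ⟪fracLaplacian (σ / 2) v, fracLaplacian (σ / 2) φ⟫_ℂ + (ω : ℂ) * ⟪v, φ⟫_ℂ =
      ∫ z, ((‖φ z‖ ^ α : ℝ) : ℂ) * φ z * (starRingEnd ℂ) (v z)

/-- A ground state: a nontrivial solution in `H^σ` with the least action among all nontrivial
solutions in `H^σ`. -/
def IsGroundState {d m : ℕ} (σ α ω : ℝ) (φ : L2 d m) : Prop :=
  IsWeakSolution σ α ω φ ∧ φ ≠ 0 ∧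
    ∀ ψ : L2 d m, IsWeakSolution σ α ω ψ → ψ ≠ 0 → action σ α ω φ ≤ action σ α ω ψ

end Waveguide

end

/-!
Put `p = α + 2` and `Q_ω(u) = ‖(-Δ)^{σ/2}u‖₂² + ω‖u‖₂²`. Everything follows from one fact: the best
constant `S(ω)` in the Sobolev inequality `S ‖u‖_p² ≤ Q_ω(u)` on `H^σ(ℝ^d × 𝕋^m)` is positive and
attained (`isLeast_bestConst`). Indeed `ℬ_ω(u) = Q_ω(u) - ‖u‖_p^p` (`nehari_eq`), so the inequality
gives `Q_ω(u) ≥ S(ω)^{p/(p-2)}` as soon as `ℬ_ω(u) ≤ 0`, `u ≠ 0`, with equality for a multiple of an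
extremiser. Hence `c_ω = (1/2 - 1/p) S(ω)^{p/(p-2)}` is the minimum both of `𝒜_ω` on the Nehari
manifold and of `ℐ_ω` on `ℬ_ω ≤ 0`. The scaled extremiser solves the Euler–Lagrange equation
(`isWeakSolution_of_extremal`), and every nontrivial weak solution lies on the Nehari manifold.
Finally `S` is an attained infimum of functions that are affine and strictly increasing in `ω`; so
it is concave, hence continuous, and strictly increasing.

The analysis is carried out with sharp frequency cut-offs `lowPass N`. Plancherel's theorem
(`hasSum_norm_sq_fourierMode`) gives `‖u - lowPass N u‖₂ ≤ N^{-σ} ‖(-Δ)^{σ/2}u‖₂`, and the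
Cauchy–Schwarz inequality on the frequency side bounds the sup norm of a function with frequencies
up to `N` by `C N^{(d+m)/2}` times its `L²` norm (`exists_norm_lowValL_le`). Interpolating between
the two, the dyadic blocks of `u` decay geometrically in `L^p` precisely in the subcritical range
(`exists_eLpNorm_sub_lowPass_le`). This yields the Sobolev inequality. It also yields the compactness
statements needed for a minimising sequence. Up to small errors in `L^p` the sequence is
band-limited at a fixed scale, so it does not vanish in sup norm; after translation along `ℝ^d` its
weak limit is nonzero, because point values of band-limited functions are weakly continuous
(`exists_shifted_weak_limit`). For the same reason the sequence converges almost everywhere along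
a subsequence (`exists_subseq_ae_tendsto_zero`). The Brezis–Lieb inequality
(`eventually_integral_rpow_le`) and the strict concavity of `t ↦ t^{2/p}` then exclude a splitting
of the mass.
-/

noncomputable section

open Filter Topology
open scoped NNReal

namespace Waveguide

/-! ### Fourier series on the torus -/

/-- The torus `𝕋^m`. -/
abbrev Torus (m : ℕ) : Type := Fin m → AddCircle (2 * Real.pi)

theorem integral_conj_fourier_mul (j k : ℤ) :
    ∫ y : AddCircle (2 * Real.pi), (starRingEnd ℂ) (fourier j y) * fourier k y =
      if j = k then ((2 * Real.pi : ℝ) : ℂ) else 0 := by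
  have h := orthonormal_iff_ite.mp (orthonormal_fourier (T := 2 * Real.pi)) j k
  rw [ContinuousMap.inner_toLp] at h
  rw [AddCircle.volume_eq_smul_haarAddCircle, integral_smul_measure,
    ENNReal.toReal_ofReal Real.two_pi_pos.le]
  simp_rw [mul_comm ((starRingEnd ℂ) _)]
  rw [h]
  split_ifs <;> simp

theorem integral_conj_torusChar_mul {m : ℕ} (j k : Fin m → ℤ) :
    ∫ y : Torus m, (starRingEnd ℂ) (torusChar j y) * torusChar k y =
      if j = k then (((2 * Real.pi) ^ m : ℝ) : ℂ) else 0 := by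
  simp_rw [torusChar, map_prod, ← Finset.prod_mul_distrib]
  rw [integral_fintype_prod_volume_eq_prod
    (fun i (y : AddCircle (2 * Real.pi)) => (starRingEnd ℂ) (fourier (j i) y) * fourier (k i) y)]
  simp_rw [integral_conj_fourier_mul]
  split_ifs with h
  · subst h; simp
  · obtain ⟨i, hi⟩ := Function.ne_iff.mp h
    exact Finset.prod_eq_zero (Finset.mem_univ i) (if_neg hi)

/-- The character `torusChar k` as a bundled continuous function. -/
def torusCharC {m : ℕ} (k : Fin m → ℤ) : C(Torus m, ℂ) := ⟨torusChar k, continuous_torusChar k⟩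

theorem torusChar_add {m : ℕ} (j k : Fin m → ℤ) (y : Torus m) :
    torusChar (j + k) y = torusChar j y * torusChar k y := by
  simp [torusChar, Finset.prod_mul_distrib]

theorem torusChar_neg {m : ℕ} (k : Fin m → ℤ) (y : Torus m) :
    torusChar (-k) y = (starRingEnd ℂ) (torusChar k y) := by
  simp [torusChar, map_prod]

/-- Trigonometric polynomials are dense in the continuous functions, by Stone–Weierstrass. -/
theorem span_torusCharC_closure_eq_top (m : ℕ) :
    (Submodule.span ℂ (range (torusCharC (m := m)))).topologicalClosure = ⊤ := by
  let A : StarSubalgebra ℂ C(Torus m, ℂ) :=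
    { toSubalgebra := Algebra.adjoin ℂ (range torusCharC)
      star_mem' := by
        change Algebra.adjoin ℂ (range torusCharC) ≤ star (Algebra.adjoin ℂ (range torusCharC))
        refine Algebra.adjoin_le ?_
        rintro _ ⟨n, rfl⟩
        refine Algebra.subset_adjoin ⟨-n, ?_⟩
        ext1 x
        exact torusChar_neg n x }
  have hA : A.toSubalgebra.toSubmodule = Submodule.span ℂ (range torusCharC) := by
    apply Algebra.adjoin_eq_span_of_subset
    refine .trans (fun x => Submonoid.closure_induction (fun _ => id) ⟨0, ?_⟩ ?_)
      Submodule.subset_span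
    · ext z
      simp [torusCharC, torusChar]
    · rintro _ _ _ _ ⟨j, rfl⟩ ⟨k, rfl⟩
      exact ⟨j + k, ContinuousMap.ext fun z => torusChar_add j k z⟩
  have hsep : A.SeparatesPoints := by
    classical
    intro x y hxy
    obtain ⟨i, hi⟩ := Function.ne_iff.mp hxy
    refine ⟨_, ⟨torusCharC (Pi.single i 1), Algebra.subset_adjoin ⟨Pi.single i 1, rfl⟩, rfl⟩, ?_⟩
    have hs : ∀ z : Torus m, torusCharC (Pi.single i 1) z = fourier 1 (z i) := by
      intro z
      change ∏ j, fourier ((Pi.single i (1 : ℤ) : Fin m → ℤ) j) (z j) = _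
      rw [Finset.prod_eq_single i]
      · simp
      · intro j _ hj; simp [hj]
      · simp
    simp only [hs]
    rw [fourier_one, fourier_one]
    exact fun h => hi (AddCircle.injective_toCircle Real.two_pi_pos.ne' (Circle.ext h))
  rw [← hA]
  exact congr_arg (Subalgebra.toSubmodule <| StarSubalgebra.toSubalgebra ·)
    (ContinuousMap.starSubalgebra_topologicalClosure_eq_top_of_separatesPoints A hsep)

/-- The characters, normalised in `L²(𝕋^m)`. -/
def torusBasisFun {m : ℕ} (k : Fin m → ℤ) : Lp ℂ 2 (volume : Measure (Torus m)) :=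
  (((Real.sqrt ((2 * Real.pi) ^ m))⁻¹ : ℝ) : ℂ) • ContinuousMap.toLp 2 volume ℂ (torusCharC k)

theorem orthonormal_torusBasisFun (m : ℕ) : Orthonormal ℂ (torusBasisFun (m := m)) := by
  rw [orthonormal_iff_ite]
  intro j k
  rw [torusBasisFun, torusBasisFun, inner_smul_left, inner_smul_right, ContinuousMap.inner_toLp]
  have h := integral_conj_torusChar_mul j k
  simp_rw [mul_comm ((starRingEnd ℂ) _)] at h
  have h' : ∫ x, torusCharC k x * (starRingEnd ℂ) (torusCharC j x) =
      if j = k then (((2 * Real.pi) ^ m : ℝ) : ℂ) else 0 := h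
  rw [h']
  split_ifs
  · have hp : (0 : ℝ) ≤ (2 * Real.pi) ^ m := by positivity
    have hs : Real.sqrt ((2 * Real.pi) ^ m) ≠ 0 := by positivity
    rw [Complex.conj_ofReal, ← Complex.ofReal_mul, ← Complex.ofReal_mul]
    norm_cast
    nth_rewrite 3 [← Real.mul_self_sqrt hp]
    field_simp
  · simp

/-- The normalised characters form a Hilbert basis of `L²(𝕋^m)`. -/
def torusBasis (m : ℕ) : HilbertBasis (Fin m → ℤ) ℂ (Lp ℂ 2 (volume : Measure (Torus m))) :=
  HilbertBasis.mk (orthonormal_torusBasisFun m) (by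
    have h : (Submodule.span ℂ (range fun k : Fin m → ℤ =>
        ContinuousMap.toLp 2 (volume : Measure (Torus m)) ℂ (torusCharC k))).topologicalClosure
          = ⊤ := by
      simpa only [Submodule.map_span, ContinuousLinearMap.coe_coe, ← range_comp,
        Function.comp_def] using
        (ContinuousMap.toLp_denseRange ℂ (volume : Measure (Torus m)) ℂ
          (by norm_num : (2 : ℝ≥0∞) ≠ ∞)).topologicalClosure_map_submodule
          (span_torusCharC_closure_eq_top m)
    rw [← h]
    refine Submodule.topologicalClosure_mono (Submodule.span_le.mpr ?_)
    rintro _ ⟨k, rfl⟩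
    have hs : (((Real.sqrt ((2 * Real.pi) ^ m))⁻¹ : ℝ) : ℂ) ≠ 0 := by
      rw [Complex.ofReal_ne_zero]; positivity
    have := Submodule.smul_mem (Submodule.span ℂ (range (torusBasisFun (m := m))))
      (((Real.sqrt ((2 * Real.pi) ^ m))⁻¹ : ℝ) : ℂ)⁻¹ (Submodule.subset_span ⟨k, rfl⟩)
    rwa [torusBasisFun, smul_smul, inv_mul_cancel₀ hs, one_smul] at this)

theorem lintegral_enorm_sq_eq_norm_sq {X : Type*} [MeasurableSpace X] {μ : Measure X}
    (f : Lp ℂ 2 μ) : ∫⁻ x, ‖f x‖ₑ ^ 2 ∂μ = ENNReal.ofReal (‖f‖ ^ 2) := by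
  rw [Lp.norm_def, ← ENNReal.toReal_pow, ENNReal.ofReal_toReal
    (ENNReal.pow_ne_top (Lp.memLp f).2.ne)]
  rw [eLpNorm_eq_lintegral_rpow_enorm_toReal (by norm_num) (by norm_num), ← ENNReal.rpow_natCast,
    ← ENNReal.rpow_mul]
  norm_num

/-- Parseval's identity on `𝕋^m`. -/
theorem lintegral_enorm_sq_torus {m : ℕ} {f : Torus m → ℂ} (hf : MemLp f 2 volume) :
    ∫⁻ y, ‖f y‖ₑ ^ 2 = ENNReal.ofReal ((2 * Real.pi) ^ m) *
      ∑' k : Fin m → ℤ, ‖(((2 * Real.pi) ^ m : ℝ) : ℂ)⁻¹ *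
        ∫ y, (starRingEnd ℂ) (torusChar k y) * f y‖ₑ ^ 2 := by
  have hs := (torusBasis m).hasSum_inner_mul_inner (hf.toLp f) (hf.toLp f)
  have hcoef : ∀ k, ⟪torusBasis m k, hf.toLp f⟫_ℂ = (((Real.sqrt ((2 * Real.pi) ^ m))⁻¹ : ℝ) : ℂ) *
      ∫ y, (starRingEnd ℂ) (torusChar k y) * f y := by
    intro k
    rw [torusBasis, HilbertBasis.coe_mk, torusBasisFun, inner_smul_left, Complex.conj_ofReal,
      L2.inner_def]
    congr 1
    refine integral_congr_ae ?_
    filter_upwards [ContinuousMap.coeFn_toLp (p := 2) (𝕜 := ℂ) volume (torusCharC k),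
      hf.coeFn_toLp] with y h1 h2
    rw [h1, h2, RCLike.inner_apply, mul_comm]
    rfl
  have hs' : HasSum (fun k => ‖⟪torusBasis m k, hf.toLp f⟫_ℂ‖ ^ 2) (‖hf.toLp f‖ ^ 2) := by
    have := RCLike.hasSum_re ℂ hs
    rw [inner_self_eq_norm_sq] at this
    refine this.congr_fun fun k => ?_
    rw [← inner_conj_symm, RCLike.mul_conj, RCLike.norm_conj]
    norm_cast
  have e : ∫⁻ y, ‖f y‖ₑ ^ 2 = ENNReal.ofReal (‖hf.toLp f‖ ^ 2) := by
    rw [← lintegral_enorm_sq_eq_norm_sq]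
    refine lintegral_congr_ae ?_
    filter_upwards [hf.coeFn_toLp] with y h2
    rw [h2]
  rw [e, ← hs'.tsum_eq, ENNReal.ofReal_tsum_of_nonneg (fun _ => by positivity) hs'.summable,
    ← ENNReal.tsum_mul_left]
  congr 1 with k
  have hp : (0 : ℝ) < (2 * Real.pi) ^ m := by positivity
  rw [hcoef, ← ofReal_norm, ← ENNReal.ofReal_pow (norm_nonneg _), ← ENNReal.ofReal_mul hp.le]
  congr 1
  generalize (2 * Real.pi) ^ m = K at hp ⊢
  rw [norm_mul, norm_mul, norm_inv, Complex.norm_real, Complex.norm_real, Real.norm_of_nonneg hp.le,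
    Real.norm_of_nonneg (by positivity), mul_pow, mul_pow, inv_pow, Real.sq_sqrt hp.le]
  field_simp

/-! ### Fourier modes on the waveguide -/

/-- The space `L²(ℝ^d)`. -/
abbrev E2 (d : ℕ) : Type := Lp ℂ 2 (volume : Measure (EuclideanSpace ℝ (Fin d)))

variable {d m : ℕ}

theorem ae_memLp_slice (u : L2 d m) :
    ∀ᵐ x : EuclideanSpace ℝ (Fin d), MemLp (fun y : Torus m => u (x, y)) 2 volume := by
  have hm : AEStronglyMeasurable (fun p : Domain d m => u p)
    ((volume : Measure (EuclideanSpace ℝ (Fin d))).prod volume) := (Lp.memLp u).1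
  have h2 := lintegral_enorm_sq_eq_norm_sq u
  have h3 : ∫⁻ x, ∫⁻ y : Torus m, ‖u (x, y)‖ₑ ^ 2 = ENNReal.ofReal (‖u‖ ^ 2) := by
    rw [← h2]
    exact (lintegral_prod (μ := (volume : Measure (EuclideanSpace ℝ (Fin d))))
      (ν := (volume : Measure (Torus m))) _ (hm.enorm.pow_const _)).symm
  have h4 := ae_lt_top' (hm.enorm.pow_const 2).lintegral_prod_right' (by rw [h3]; simp)
  filter_upwards [h4, hm.prodMk_left] with x hx hx'
  refine ⟨hx', ?_⟩
  rw [eLpNorm_lt_top_iff_lintegral_rpow_enorm_lt_top (by norm_num) (by norm_num)]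
  simpa using hx

theorem ae_integrable_slice (u : L2 d m) (k : Fin m → ℤ) :
    ∀ᵐ x : EuclideanSpace ℝ (Fin d),
      Integrable (fun y : Torus m => (starRingEnd ℂ) (torusChar k y) * u (x, y)) := by
  filter_upwards [ae_memLp_slice u] with x hx
  refine (hx.integrable (by norm_num)).bdd_mul (c := 1) ?_ ?_
  · exact (Complex.continuous_conj.comp (continuous_torusChar k)).aestronglyMeasurable
  · exact Eventually.of_forall fun y => by simp [norm_torusChar]

/-- The `k`-th torus coefficient as an element of `L²(ℝ^d)`. -/
def coeffLp (u : L2 d m) (k : Fin m → ℤ) : E2 d := (memLp_torusCoeff u k).toLp (torusCoeff u k)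

theorem coeFn_coeffLp (u : L2 d m) (k : Fin m → ℤ) : coeffLp u k =ᵐ[volume] torusCoeff u k :=
  (memLp_torusCoeff u k).coeFn_toLp

theorem fourierMode_eq (u : L2 d m) (k : Fin m → ℤ) : fourierMode u k = 𝓕 (coeffLp u k) := rfl

theorem ae_slice_of_ae {p : Domain d m → Prop} (h : ∀ᵐ z, p z) :
    ∀ᵐ x : EuclideanSpace ℝ (Fin d), ∀ᵐ y : Torus m, p (x, y) :=
  Measure.ae_ae_of_ae_prod h

theorem coeffLp_add (u v : L2 d m) (k : Fin m → ℤ) :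
    coeffLp (u + v) k = coeffLp u k + coeffLp v k := by
  refine Lp.ext ?_
  filter_upwards [coeFn_coeffLp (u + v) k, coeFn_coeffLp u k, coeFn_coeffLp v k,
    Lp.coeFn_add (coeffLp u k) (coeffLp v k), ae_slice_of_ae (Lp.coeFn_add u v),
    ae_integrable_slice u k, ae_integrable_slice v k] with x h1 h2 h3 h4 h5 h6 h7
  rw [h1, h4, Pi.add_apply, h2, h3, torusCoeff, torusCoeff, torusCoeff, ← mul_add,
    ← integral_add h6 h7]
  congr 1
  refine integral_congr_ae ?_
  filter_upwards [h5] with y hy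
  rw [hy, Pi.add_apply, mul_add]

theorem coeffLp_smul (c : ℂ) (u : L2 d m) (k : Fin m → ℤ) :
    coeffLp (c • u) k = c • coeffLp u k := by
  refine Lp.ext ?_
  filter_upwards [coeFn_coeffLp (c • u) k, coeFn_coeffLp u k,
    Lp.coeFn_smul c (coeffLp u k), ae_slice_of_ae (Lp.coeFn_smul c u)] with x h1 h2 h4 h5
  rw [h1, h4, Pi.smul_apply, h2, torusCoeff, torusCoeff, smul_eq_mul, mul_left_comm]
  congr 1
  refine Eq.trans ?_ (integral_const_mul c _)
  refine integral_congr_ae ?_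
  filter_upwards [h5] with y hy
  rw [hy, Pi.smul_apply, smul_eq_mul, mul_left_comm]

/-- Parseval's identity on `ℝ^d × 𝕋^m`. -/
theorem hasSum_norm_sq_fourierMode (u : L2 d m) :
    HasSum (fun k : Fin m → ℤ => (2 * Real.pi) ^ m * ‖fourierMode u k‖ ^ 2) (‖u‖ ^ 2) := by
  have hm : AEStronglyMeasurable (fun p : Domain d m => u p)
    ((volume : Measure (EuclideanSpace ℝ (Fin d))).prod volume) := (Lp.memLp u).1
  have hp : (0 : ℝ) < (2 * Real.pi) ^ m := by positivity
  have key : ENNReal.ofReal (‖u‖ ^ 2) =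
      ∑' k : Fin m → ℤ, ENNReal.ofReal ((2 * Real.pi) ^ m * ‖fourierMode u k‖ ^ 2) := by
    calc ENNReal.ofReal (‖u‖ ^ 2) = ∫⁻ x, ∫⁻ y : Torus m, ‖u (x, y)‖ₑ ^ 2 := by
          rw [← lintegral_enorm_sq_eq_norm_sq u]
          exact lintegral_prod (μ := (volume : Measure (EuclideanSpace ℝ (Fin d))))
            (ν := (volume : Measure (Torus m))) _ (hm.enorm.pow_const _)
      _ = ∫⁻ x, ∑' k : Fin m → ℤ, ENNReal.ofReal ((2 * Real.pi) ^ m) * ‖coeffLp u k x‖ₑ ^ 2 := by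
          refine lintegral_congr_ae ?_
          filter_upwards [ae_memLp_slice u, ae_all_iff.mpr (coeFn_coeffLp u)] with x hx hx'
          rw [lintegral_enorm_sq_torus hx, ← ENNReal.tsum_mul_left]
          congr 1 with k
          rw [hx']
          rfl
      _ = ∑' k : Fin m → ℤ, ∫⁻ x, ENNReal.ofReal ((2 * Real.pi) ^ m) * ‖coeffLp u k x‖ₑ ^ 2 :=
          lintegral_tsum fun k =>
            ((Lp.memLp (coeffLp u k)).1.enorm.pow_const 2).const_mul _
      _ = _ := by
          congr 1 with k
          rw [lintegral_const_mul' _ _ ENNReal.ofReal_ne_top, lintegral_enorm_sq_eq_norm_sq,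
            fourierMode_eq, Lp.norm_fourier_eq, ENNReal.ofReal_mul hp.le]
  have hsum : Summable fun k : Fin m → ℤ => (2 * Real.pi) ^ m * ‖fourierMode u k‖ ^ 2 := by
    have hfin : ∑' k : Fin m → ℤ, ENNReal.ofReal ((2 * Real.pi) ^ m * ‖fourierMode u k‖ ^ 2) ≠ ∞ :=
      key ▸ ENNReal.ofReal_ne_top
    refine (ENNReal.summable_toReal hfin).congr fun k => ?_
    rw [ENNReal.toReal_ofReal (by positivity)]
  rw [← ENNReal.ofReal_tsum_of_nonneg (fun _ => by positivity) hsum] at key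
  have := (ENNReal.ofReal_eq_ofReal_iff (by positivity)
    (tsum_nonneg fun _ => by positivity)).mp key
  rw [this]
  exact hsum.hasSum

theorem norm_fourierMode_sq_le (u : L2 d m) (k : Fin m → ℤ) :
    (2 * Real.pi) ^ m * ‖fourierMode u k‖ ^ 2 ≤ ‖u‖ ^ 2 :=
  le_hasSum (hasSum_norm_sq_fourierMode u) k fun _ _ => by positivity

theorem norm_fourierMode_le (u : L2 d m) (k : Fin m → ℤ) : ‖fourierMode u k‖ ≤ ‖u‖ := by
  have h := norm_fourierMode_sq_le u k
  have h1 : (1 : ℝ) ≤ (2 * Real.pi) ^ m := one_le_pow₀ (by linarith [Real.pi_gt_three])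
  refine le_of_sq_le_sq ?_ (norm_nonneg _)
  nlinarith [sq_nonneg ‖fourierMode u k‖]

/-- `u ↦ û(·, k)` as a bounded linear map. -/
def modeL (k : Fin m → ℤ) : L2 d m →L[ℂ] E2 d :=
  LinearMap.mkContinuous
    { toFun := fun u => fourierMode u k
      map_add' := fun u v => by
        rw [fourierMode_eq, fourierMode_eq, fourierMode_eq, coeffLp_add, FourierTransform.fourier_add]
      map_smul' := fun c u => by
        rw [fourierMode_eq, fourierMode_eq, coeffLp_smul, FourierTransform.fourier_smul,
          RingHom.id_apply] }
    1 fun u => by rw [one_mul]; exact norm_fourierMode_le u k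

@[simp]
theorem modeL_apply (k : Fin m → ℤ) (u : L2 d m) : modeL k u = fourierMode u k := rfl

/-- A function is determined by its Fourier modes. -/
theorem ext_fourierMode {u v : L2 d m} (h : ∀ k, fourierMode u k = fourierMode v k) : u = v := by
  rw [← sub_eq_zero, ← norm_eq_zero, ← sq_eq_zero_iff]
  refine (hasSum_norm_sq_fourierMode (u - v)).unique ?_
  have : ∀ k, fourierMode (u - v) k = 0 := fun k => by
    rw [← modeL_apply, map_sub, modeL_apply, modeL_apply, h, sub_self]
  simp [this, hasSum_zero]

/-! ### The Fourier transform on `L²(ℝ^d)` -/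

section Multiplication

variable {X : Type*} [MeasurableSpace X] {μ : Measure X}

theorem memLp_bounded_mul {φ : X → ℂ} (hφ : Measurable φ) (hb : ∀ x, ‖φ x‖ ≤ 1) (f : Lp ℂ 2 μ) :
    MemLp (fun x => φ x * f x) 2 μ :=
  (Lp.memLp f).of_le (hφ.aestronglyMeasurable.mul (Lp.aestronglyMeasurable f))
    (Eventually.of_forall fun x => by
      rw [norm_mul]; exact mul_le_of_le_one_left (norm_nonneg _) (hb x))

/-- Multiplication by a measurable function bounded by `1`, as a bounded operator on `L²`. -/
def mulL (φ : X → ℂ) (hφ : Measurable φ) (hb : ∀ x, ‖φ x‖ ≤ 1) : Lp ℂ 2 μ →L[ℂ] Lp ℂ 2 μ :=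
  LinearMap.mkContinuous
    { toFun := fun f => (memLp_bounded_mul hφ hb f).toLp _
      map_add' := fun f g => by
        refine Lp.ext ?_
        filter_upwards [(memLp_bounded_mul hφ hb (f + g)).coeFn_toLp,
          (memLp_bounded_mul hφ hb f).coeFn_toLp, (memLp_bounded_mul hφ hb g).coeFn_toLp,
          Lp.coeFn_add ((memLp_bounded_mul hφ hb f).toLp _) ((memLp_bounded_mul hφ hb g).toLp _),
          Lp.coeFn_add f g] with x h1 h2 h3 h4 h5
        rw [h1, h4, Pi.add_apply, h2, h3, h5, Pi.add_apply, mul_add]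
      map_smul' := fun c f => by
        refine Lp.ext ?_
        filter_upwards [(memLp_bounded_mul hφ hb (c • f)).coeFn_toLp,
          (memLp_bounded_mul hφ hb f).coeFn_toLp,
          Lp.coeFn_smul c ((memLp_bounded_mul hφ hb f).toLp _), Lp.coeFn_smul c f]
          with x h1 h2 h4 h5
        rw [h1, RingHom.id_apply, h4, Pi.smul_apply, h2, h5, Pi.smul_apply, smul_eq_mul,
          smul_eq_mul, mul_left_comm] }
    1 fun f => by
      rw [one_mul]
      refine Lp.norm_le_norm_of_ae_le ?_
      filter_upwards [(memLp_bounded_mul hφ hb f).coeFn_toLp] with x hx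
      change ‖(memLp_bounded_mul hφ hb f).toLp _ x‖ ≤ _
      rw [hx, norm_mul]
      exact mul_le_of_le_one_left (norm_nonneg _) (hb x)

theorem coeFn_mulL {φ : X → ℂ} (hφ : Measurable φ) (hb : ∀ x, ‖φ x‖ ≤ 1) (f : Lp ℂ 2 μ) :
    mulL φ hφ hb f =ᵐ[μ] fun x => φ x * f x :=
  (memLp_bounded_mul hφ hb f).coeFn_toLp

theorem norm_mulL_le {φ : X → ℂ} (hφ : Measurable φ) (hb : ∀ x, ‖φ x‖ ≤ 1) (f : Lp ℂ 2 μ) :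
    ‖mulL φ hφ hb f‖ ≤ ‖f‖ := by
  refine Lp.norm_le_norm_of_ae_le ?_
  filter_upwards [coeFn_mulL hφ hb f] with x hx
  rw [hx, norm_mul]
  exact mul_le_of_le_one_left (norm_nonneg _) (hb x)

end Multiplication

/-- On `L¹ ∩ L²`, the inverse Fourier transform is given by the integral. -/
theorem coeFn_fourierInv_of_integrable {g : E2 d} (hg : Integrable g) :
    (𝓕⁻ g : E2 d) =ᵐ[volume] 𝓕⁻ (g : EuclideanSpace ℝ (Fin d) → ℂ) := by
  have hcont : Continuous (𝓕⁻ (g : EuclideanSpace ℝ (Fin d) → ℂ)) :=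
    VectorFourier.fourierIntegral_continuous Real.continuous_fourierChar
      (by
        have : Continuous fun p : EuclideanSpace ℝ (Fin d) × EuclideanSpace ℝ (Fin d) =>
          -⟪p.1, p.2⟫_ℝ := by fun_prop
        exact this) hg
  refine ae_eq_of_integral_contDiff_smul_eq ((Lp.memLp _).locallyIntegrable (by norm_num))
    hcont.locallyIntegrable ?_
  intro ψ hψ hψc
  have hg₁ : HasCompactSupport (Complex.ofRealCLM ∘ ψ) := hψc.comp_left rfl
  have hg₂ : ContDiff ℝ (⊤ : ℕ∞) (Complex.ofRealCLM ∘ ψ) := Complex.ofRealCLM.contDiff.comp hψ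
  set Ψ : SchwartzMap (EuclideanSpace ℝ (Fin d)) ℂ := hg₁.toSchwartzMap hg₂ with hΨ
  have hΨv : ∀ x, Ψ x = (ψ x : ℂ) := fun x => rfl
  have h1 : Lp.toTemperedDistribution (𝓕⁻ g) Ψ = Lp.toTemperedDistribution g (𝓕⁻ Ψ) := by
    rw [← Lp.fourierInv_toTemperedDistribution_eq, TemperedDistribution.fourierInv_apply]
  rw [Lp.toTemperedDistribution_apply, Lp.toTemperedDistribution_apply] at h1
  have h2 : ∫ x, (𝓕⁻ Ψ) x • g x = ∫ x, Ψ x • 𝓕⁻ (g : EuclideanSpace ℝ (Fin d) → ℂ) x := by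
    rw [SchwartzMap.fourierInv_coe]
    have := VectorFourier.integral_fourierIntegral_smul_eq_flip
      (L := -innerₗ (EuclideanSpace ℝ (Fin d))) (μ := volume) (ν := volume)
      Real.continuous_fourierChar
      (by
        have : Continuous fun p : EuclideanSpace ℝ (Fin d) × EuclideanSpace ℝ (Fin d) =>
          -⟪p.1, p.2⟫_ℝ := by fun_prop
        exact this) Ψ.integrable hg
    refine this.trans ?_
    have hflip : (-innerₗ (EuclideanSpace ℝ (Fin d))).flip = -innerₗ (EuclideanSpace ℝ (Fin d)) := by
      ext x y
      simp [real_inner_comm]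
    rw [hflip]
    rfl
  rw [h2] at h1
  exact h1

/-- The plane wave `ξ ↦ exp(2πi ξ · x)`. -/
def planeWave (x : EuclideanSpace ℝ (Fin d)) (ξ : EuclideanSpace ℝ (Fin d)) : ℂ :=
  (Real.fourierChar ⟪ξ, x⟫_ℝ : ℂ)

theorem continuous_planeWave (x : EuclideanSpace ℝ (Fin d)) : Continuous (planeWave x) := by
  unfold planeWave
  exact continuous_subtype_val.comp (Real.continuous_fourierChar.comp (by fun_prop))

theorem norm_planeWave (x ξ : EuclideanSpace ℝ (Fin d)) : ‖planeWave x ξ‖ = 1 :=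
  Circle.norm_coe _

theorem planeWave_add (x a ξ : EuclideanSpace ℝ (Fin d)) :
    planeWave (x + a) ξ = planeWave x ξ * planeWave a ξ := by
  rw [planeWave, inner_add_right, AddChar.map_add_eq_mul, Circle.coe_mul]
  rfl

theorem fourierInv_eq_integral_planeWave (g : EuclideanSpace ℝ (Fin d) → ℂ)
    (x : EuclideanSpace ℝ (Fin d)) : 𝓕⁻ g x = ∫ ξ, planeWave x ξ * g ξ := by
  rw [Real.fourierInv_eq]
  rfl

/-- Multiplication by the plane wave `ξ ↦ exp(2πi ξ · a)` on `L²(ℝ^d)`. -/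
def modulateL (a : EuclideanSpace ℝ (Fin d)) : E2 d →L[ℂ] E2 d :=
  mulL (planeWave a) (continuous_planeWave a).measurable fun ξ => (norm_planeWave a ξ).le

theorem coeFn_modulateL (a : EuclideanSpace ℝ (Fin d)) (g : E2 d) :
    modulateL a g =ᵐ[volume] fun ξ => planeWave a ξ * g ξ := coeFn_mulL _ _ g

/-- Translation `g ↦ g(· + a)` on `L²(ℝ^d)`. -/
def translateL (a : EuclideanSpace ℝ (Fin d)) : E2 d →ₗᵢ[ℂ] E2 d :=
  Lp.compMeasurePreservingₗᵢ ℂ (fun x => x + a) (measurePreserving_add_right volume a)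

theorem coeFn_translateL (a : EuclideanSpace ℝ (Fin d)) (g : E2 d) :
    translateL a g =ᵐ[volume] fun x => g (x + a) :=
  Lp.coeFn_compMeasurePreserving g (measurePreserving_add_right volume a)

/-- Translation is modulation on the Fourier side. For Schwartz functions this is read off the
Fourier integral; the general case follows by density. -/
theorem translateL_fourierInv (a : EuclideanSpace ℝ (Fin d)) (h : E2 d) :
    translateL a (𝓕⁻ h) = 𝓕⁻ (modulateL a h) := by
  refine DenseRange.induction_on (p := fun h : E2 d => translateL a (𝓕⁻ h) = 𝓕⁻ (modulateL a h))
    (SchwartzMap.denseRange_toLpCLM (E := EuclideanSpace ℝ (Fin d)) (F := ℂ) (p := 2)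
      (μ := volume) ENNReal.ofNat_ne_top) h ?_ ?_
  · refine isClosed_eq ?_ ?_
    · exact (translateL a).continuous.comp (Lp.fourierTransformₗᵢ _ ℂ).symm.continuous
    · exact (Lp.fourierTransformₗᵢ _ ℂ).symm.continuous.comp (modulateL a).continuous
  · intro f
    set g : E2 d := SchwartzMap.toLpCLM ℝ ℂ 2 volume f with hg
    have hgf : g =ᵐ[volume] f := SchwartzMap.coeFn_toLp f 2 volume
    have hgi : Integrable g := f.integrable.congr hgf.symm
    have hmi : Integrable (modulateL a g) := by
      refine Integrable.congr ?_ (coeFn_modulateL a g).symm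
      exact hgi.bdd_mul (c := 1) (continuous_planeWave a).aestronglyMeasurable
        (Eventually.of_forall fun ξ => (norm_planeWave a ξ).le)
    refine Lp.ext ?_
    have h1 := (measurePreserving_add_right volume a).quasiMeasurePreserving.ae_eq_comp
      (coeFn_fourierInv_of_integrable hgi)
    filter_upwards [coeFn_translateL a (𝓕⁻ g), coeFn_fourierInv_of_integrable hmi, h1]
      with x h2 h3 h4
    simp only [Function.comp_apply] at h4
    rw [h2, h3, h4, fourierInv_eq_integral_planeWave, fourierInv_eq_integral_planeWave]
    refine integral_congr_ae ?_
    filter_upwards [coeFn_modulateL a g] with ξ hξ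
    rw [hξ, planeWave_add, mul_assoc]

theorem fourier_translateL (a : EuclideanSpace ℝ (Fin d)) (g : E2 d) :
    𝓕 (translateL a g) = modulateL a (𝓕 g) := by
  have h := translateL_fourierInv a (𝓕 g)
  rw [FourierTransform.fourierInv_fourier_eq] at h
  rw [h, FourierTransform.fourier_fourierInv_eq]

/-! ### Translations of the waveguide along `ℝ^d` -/

theorem measurePreserving_shift (a : EuclideanSpace ℝ (Fin d)) :
    MeasurePreserving (fun z : Domain d m => (z.1 + a, z.2)) volume volume :=
  (measurePreserving_add_right volume a).prod (MeasurePreserving.id volume)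

/-- Translation `u ↦ u(· + a, ·)` on `L²(ℝ^d × 𝕋^m)`. -/
def shiftL (a : EuclideanSpace ℝ (Fin d)) : L2 d m →ₗᵢ[ℂ] L2 d m :=
  Lp.compMeasurePreservingₗᵢ ℂ _ (measurePreserving_shift a)

theorem coeFn_shiftL (a : EuclideanSpace ℝ (Fin d)) (u : L2 d m) :
    shiftL a u =ᵐ[volume] fun z => u (z.1 + a, z.2) :=
  Lp.coeFn_compMeasurePreserving u (measurePreserving_shift a)

theorem fourierMode_shiftL (a : EuclideanSpace ℝ (Fin d)) (u : L2 d m) (k : Fin m → ℤ) :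
    fourierMode (shiftL a u) k = modulateL a (fourierMode u k) := by
  rw [fourierMode_eq, fourierMode_eq, ← fourier_translateL]
  congr 1
  refine Lp.ext ?_
  have h1 := (measurePreserving_add_right volume a).quasiMeasurePreserving.ae_eq_comp
    (coeFn_coeffLp u k)
  filter_upwards [coeFn_coeffLp (shiftL a u) k, coeFn_translateL a (coeffLp u k), h1,
    ae_slice_of_ae (coeFn_shiftL a u)] with x h2 h3 h4 h5
  simp only [Function.comp_apply] at h4
  rw [h2, h3, h4, torusCoeff, torusCoeff]
  congr 1
  refine integral_congr_ae ?_
  filter_upwards [h5] with y hy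
  rw [hy]

/-! ### Pure modes -/

theorem memLp_tensor (g : E2 d) (k : Fin m → ℤ) :
    MemLp (fun z : Domain d m => g z.1 * torusChar k z.2) 2 volume := by
  have hm : AEStronglyMeasurable (fun z : Domain d m => g z.1 * torusChar k z.2)
      ((volume : Measure (EuclideanSpace ℝ (Fin d))).prod volume) :=
    (Lp.aestronglyMeasurable g).comp_fst.mul
      ((continuous_torusChar k).comp continuous_snd).aestronglyMeasurable
  refine ⟨hm, ?_⟩
  rw [eLpNorm_lt_top_iff_lintegral_rpow_enorm_lt_top (by norm_num) (by norm_num)]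
  have h1 : ∫⁻ z : Domain d m, ‖g z.1 * torusChar k z.2‖ₑ ^ (2 : ℝ≥0∞).toReal =
      ∫⁻ x, ∫⁻ y : Torus m, ‖g x * torusChar k y‖ₑ ^ (2 : ℝ≥0∞).toReal :=
    lintegral_prod (μ := (volume : Measure (EuclideanSpace ℝ (Fin d))))
      (ν := (volume : Measure (Torus m))) _ (hm.enorm.pow_const _)
  have h2 : ∀ y : Torus m, ‖torusChar k y‖ₑ = 1 := fun y => by
    rw [← ofReal_norm, norm_torusChar, ENNReal.ofReal_one]
  rw [h1]
  simp_rw [enorm_mul, h2, mul_one, lintegral_const]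
  rw [lintegral_mul_const' _ _ (measure_ne_top _ _)]
  refine ENNReal.mul_lt_top ?_ (measure_lt_top _ _)
  simpa using (lintegral_enorm_sq_eq_norm_sq g).trans_lt ENNReal.ofReal_lt_top

/-- The function `(x, y) ↦ g(x) exp(i k · y)`. -/
def tensor (g : E2 d) (k : Fin m → ℤ) : L2 d m := (memLp_tensor g k).toLp _

theorem coeFn_tensor (g : E2 d) (k : Fin m → ℤ) :
    tensor g k =ᵐ[volume] fun z => g z.1 * torusChar k z.2 := (memLp_tensor g k).coeFn_toLp

/-- By orthogonality of the characters, `g(x) exp(i k · y)` has a single nonzero mode. -/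
theorem fourierMode_tensor (g : E2 d) (j k : Fin m → ℤ) :
    fourierMode (tensor g k) j = if j = k then 𝓕 g else 0 := by
  have h : coeffLp (tensor g k) j = if j = k then g else 0 := by
    refine Lp.ext ?_
    filter_upwards [coeFn_coeffLp (tensor g k) j, ae_slice_of_ae (coeFn_tensor g k),
      Lp.coeFn_zero ℂ 2 (volume : Measure (EuclideanSpace ℝ (Fin d)))] with x h1 h2 h3
    have h4 : ∫ y, (starRingEnd ℂ) (torusChar j y) * tensor g k (x, y) =
        g x * ∫ y, (starRingEnd ℂ) (torusChar j y) * torusChar k y := by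
      refine Eq.trans (integral_congr_ae ?_) (integral_const_mul (g x) _)
      filter_upwards [h2] with y hy
      rw [hy, mul_left_comm]
    rw [h1, torusCoeff, h4, integral_conj_torusChar_mul]
    have hp : (((2 * Real.pi) ^ m : ℝ) : ℂ) ≠ 0 := by
      rw [Complex.ofReal_ne_zero]; positivity
    split_ifs
    · rw [mul_left_comm, inv_mul_cancel₀ hp, mul_one]
    · rw [h3]; simp
  rw [fourierMode_eq, h]
  split_ifs
  · rfl
  · exact (Lp.fourierTransformₗᵢ _ ℂ).map_zero

/-! ### Frequency cut-offs -/

theorem lowPass_indicator_measurable (N : ℕ) : Measurable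
    ((Metric.closedBall (0 : EuclideanSpace ℝ (Fin d)) N).indicator (fun _ => (1 : ℂ))) :=
  measurable_const.indicator Metric.isClosed_closedBall.measurableSet

theorem norm_lowPass_indicator_le (N : ℕ) (ξ : EuclideanSpace ℝ (Fin d)) :
    ‖(Metric.closedBall (0 : EuclideanSpace ℝ (Fin d)) N).indicator (fun _ => (1 : ℂ)) ξ‖ ≤ 1 := by
  by_cases h : ξ ∈ Metric.closedBall (0 : EuclideanSpace ℝ (Fin d)) N <;> simp [h]

/-- Restriction of a function on `ℝ^d` to the ball `|ξ| ≤ N`. -/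
def cutL (N : ℕ) : E2 d →L[ℂ] E2 d :=
  mulL _ (lowPass_indicator_measurable N) (norm_lowPass_indicator_le N)

theorem coeFn_cutL (N : ℕ) (g : E2 d) : cutL N g =ᵐ[volume] fun ξ =>
    (Metric.closedBall (0 : EuclideanSpace ℝ (Fin d)) N).indicator (fun _ => (1 : ℂ)) ξ * g ξ :=
  coeFn_mulL _ _ g

theorem norm_cutL_le (N : ℕ) (g : E2 d) : ‖cutL N g‖ ≤ ‖g‖ := norm_mulL_le _ _ g

theorem cutL_cutL {N M : ℕ} (h : N ≤ M) (g : E2 d) : cutL M (cutL N g) = cutL N g := by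
  refine Lp.ext ?_
  filter_upwards [coeFn_cutL M (cutL N g), coeFn_cutL N g] with ξ h1 h2
  rw [h1, h2]
  by_cases hξ : ξ ∈ Metric.closedBall (0 : EuclideanSpace ℝ (Fin d)) N
  · have hM : ξ ∈ Metric.closedBall (0 : EuclideanSpace ℝ (Fin d)) M :=
      Metric.closedBall_subset_closedBall (by exact_mod_cast h) hξ
    simp [indicator_of_mem hξ, indicator_of_mem hM]
  · simp [indicator_of_notMem hξ]

/-- The torus frequencies `k` with `|k_i| ≤ N` for all `i`. -/
def cube (m N : ℕ) : Finset (Fin m → ℤ) := Fintype.piFinset fun _ => Finset.Icc (-(N : ℤ)) N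

theorem mem_cube {N : ℕ} {k : Fin m → ℤ} : k ∈ cube m N ↔ ∀ i, |k i| ≤ N := by
  simp [cube, abs_le]

theorem cube_subset {N M : ℕ} (h : N ≤ M) : cube m N ⊆ cube m M := fun k hk =>
  mem_cube.mpr fun i => (mem_cube.mp hk i).trans (by exact_mod_cast h)

theorem card_cube (m N : ℕ) : (cube m N).card = (2 * N + 1) ^ m := by
  simp only [cube, Fintype.card_piFinset, Int.card_Icc, Finset.prod_const, Finset.card_univ,
    Fintype.card_fin]
  congr 1
  omega

/-- The part of `u` with frequencies `|ξ| ≤ N`, `|k_i| ≤ N`. -/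
def lowPass (N : ℕ) (u : L2 d m) : L2 d m :=
  ∑ k ∈ cube m N, tensor (𝓕⁻ (cutL N (fourierMode u k))) k

theorem fourierMode_lowPass (N : ℕ) (u : L2 d m) (k : Fin m → ℤ) :
    fourierMode (lowPass N u) k = if k ∈ cube m N then cutL N (fourierMode u k) else 0 := by
  rw [← modeL_apply, lowPass, map_sum]
  simp_rw [modeL_apply, fourierMode_tensor, FourierTransform.fourier_fourierInv_eq]
  rw [Finset.sum_ite_eq]

theorem fourierMode_sub (u v : L2 d m) (k : Fin m → ℤ) :
    fourierMode (u - v) k = fourierMode u k - fourierMode v k := (modeL k).map_sub u v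

theorem lowPass_sub (N : ℕ) (u v : L2 d m) : lowPass N (u - v) = lowPass N u - lowPass N v := by
  refine ext_fourierMode fun k => ?_
  rw [fourierMode_sub, fourierMode_lowPass, fourierMode_lowPass, fourierMode_lowPass,
    fourierMode_sub]
  split_ifs
  · rw [map_sub]
  · rw [sub_zero]

theorem lowPass_lowPass {N M : ℕ} (h : N ≤ M) (u : L2 d m) :
    lowPass M (lowPass N u) = lowPass N u := by
  refine ext_fourierMode fun k => ?_
  simp only [fourierMode_lowPass]
  by_cases hk : k ∈ cube m N
  · rw [if_pos hk, if_pos (cube_subset h hk), cutL_cutL h]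
  · rw [if_neg hk, map_zero, ite_self]

theorem norm_le_of_norm_fourierMode_le {u v : L2 d m} {c : ℝ} (hc : 0 ≤ c)
    (h : ∀ k, ‖fourierMode u k‖ ≤ c * ‖fourierMode v k‖) : ‖u‖ ≤ c * ‖v‖ := by
  refine le_of_sq_le_sq ?_ (by positivity)
  rw [mul_pow]
  refine hasSum_le (fun k => ?_) (hasSum_norm_sq_fourierMode u)
    ((hasSum_norm_sq_fourierMode v).mul_left (c ^ 2))
  have h1 : ‖fourierMode u k‖ ^ 2 ≤ (c * ‖fourierMode v k‖) ^ 2 :=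
    pow_le_pow_left₀ (norm_nonneg _) (h k) 2
  have hp : (0 : ℝ) < (2 * Real.pi) ^ m := by positivity
  nlinarith

theorem norm_lowPass_le (N : ℕ) (u : L2 d m) : ‖lowPass N u‖ ≤ ‖u‖ := by
  have := norm_le_of_norm_fourierMode_le (u := lowPass N u) (v := u) zero_le_one fun k => by
    rw [fourierMode_lowPass, one_mul]
    split_ifs
    · exact norm_cutL_le N _
    · simp
  rwa [one_mul] at this

theorem laplaceSymbol_nonneg (ξ : EuclideanSpace ℝ (Fin d)) (k : Fin m → ℤ) :
    0 ≤ laplaceSymbol ξ k := by unfold laplaceSymbol; positivity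

/-- Outside the frequency window of size `N` the symbol of `(-Δ)^{σ/2}` is at least `N^σ`. -/
theorem rpow_le_laplaceSymbol_rpow {σ : ℝ} (hσ : 0 < σ) (N : ℕ) (ξ : EuclideanSpace ℝ (Fin d))
    (k : Fin m → ℤ) (h : k ∉ cube m N ∨ ξ ∉ Metric.closedBall (0 : EuclideanSpace ℝ (Fin d)) N) :
    (N : ℝ) ^ σ ≤ laplaceSymbol ξ k ^ (σ / 2) := by
  have key : (N : ℝ) ^ 2 ≤ laplaceSymbol ξ k := by
    unfold laplaceSymbol
    rcases h with h | h
    · rw [mem_cube] at h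
      push Not at h
      obtain ⟨i, hi⟩ := h
      have h1 : (N : ℝ) ^ 2 ≤ (k i : ℝ) ^ 2 := by
        rw [← sq_abs (k i : ℝ)]
        have : (N : ℝ) ≤ |(k i : ℝ)| := by exact_mod_cast hi.le
        gcongr
      have h2 : (k i : ℝ) ^ 2 ≤ ∑ i, (k i : ℝ) ^ 2 :=
        Finset.single_le_sum (f := fun i => (k i : ℝ) ^ 2) (fun _ _ => sq_nonneg _)
          (Finset.mem_univ i)
      have h3 : 0 ≤ (2 * Real.pi * ‖ξ‖) ^ 2 := sq_nonneg _
      linarith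
    · have h1 : (N : ℝ) < ‖ξ‖ := by simpa using h
      have h2 : (N : ℝ) ≤ 2 * Real.pi * ‖ξ‖ := by
        nlinarith [Real.pi_gt_three, norm_nonneg ξ]
      have h3 : (N : ℝ) ^ 2 ≤ (2 * Real.pi * ‖ξ‖) ^ 2 := by gcongr
      have h4 : 0 ≤ ∑ i, (k i : ℝ) ^ 2 := by positivity
      linarith
  calc (N : ℝ) ^ σ = ((N : ℝ) ^ 2) ^ (σ / 2) := by
        rw [← Real.rpow_natCast, ← Real.rpow_mul (by positivity)]
        congr 1
        push_cast
        ring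
    _ ≤ _ := Real.rpow_le_rpow (by positivity) key (by positivity)

/-- High frequencies are controlled by the fractional derivative. -/
theorem norm_sub_lowPass_le {σ : ℝ} (hσ : 0 < σ) {N : ℕ} (hN : 1 ≤ N) {u w : L2 d m}
    (h : IsFracLaplacian (σ / 2) u w) : ‖u - lowPass N u‖ ≤ (N : ℝ) ^ (-σ) * ‖w‖ := by
  have hN0 : (0 : ℝ) < N := by exact_mod_cast hN
  refine norm_le_of_norm_fourierMode_le (by positivity) fun k => ?_
  refine Lp.norm_le_mul_norm_of_ae_le_mul ?_
  rw [fourierMode_sub, fourierMode_lowPass]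
  have claim : ∀ ξ : EuclideanSpace ℝ (Fin d),
      (k ∉ cube m N ∨ ξ ∉ Metric.closedBall (0 : EuclideanSpace ℝ (Fin d)) N) →
      ‖fourierMode u k ξ‖ ≤ (N : ℝ) ^ (-σ) *
        ‖((laplaceSymbol ξ k ^ (σ / 2) : ℝ) : ℂ) * fourierMode u k ξ‖ := by
    intro ξ hξ
    have h1 := rpow_le_laplaceSymbol_rpow hσ N ξ k hξ
    rw [norm_mul, Complex.norm_real, Real.norm_of_nonneg
      (Real.rpow_nonneg (laplaceSymbol_nonneg ξ k) _), Real.rpow_neg hN0.le, ← mul_assoc]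
    refine le_mul_of_one_le_left (norm_nonneg _) ?_
    rw [inv_mul_eq_div, one_le_div (by positivity)]
    exact h1
  split_ifs with hk
  · filter_upwards [h k, Lp.coeFn_sub (fourierMode u k) (cutL N (fourierMode u k)),
      coeFn_cutL N (fourierMode u k)] with ξ h1 h2 h3
    rw [h2, Pi.sub_apply, h3, h1]
    by_cases hξ : ξ ∈ Metric.closedBall (0 : EuclideanSpace ℝ (Fin d)) N
    · rw [indicator_of_mem hξ, one_mul, sub_self, norm_zero]
      positivity
    · rw [indicator_of_notMem hξ, zero_mul, sub_zero]
      exact claim ξ (Or.inr hξ)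
  · rw [sub_zero]
    filter_upwards [h k] with ξ h1
    rw [h1]
    exact claim ξ (Or.inl hk)

/-! ### Pointwise values of band-limited functions -/

theorem memLp_waveLp (N : ℕ) (x : EuclideanSpace ℝ (Fin d)) :
    MemLp ((Metric.closedBall (0 : EuclideanSpace ℝ (Fin d)) N).indicator
      fun ξ => (starRingEnd ℂ) (planeWave x ξ)) 2 volume := by
  refine MemLp.of_le (g := (Metric.closedBall (0 : EuclideanSpace ℝ (Fin d)) N).indicator
      fun _ => (1 : ℝ)) ?_ ?_ ?_
  · exact memLp_indicator_const 2 Metric.isClosed_closedBall.measurableSet 1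
      (Or.inr (measure_closedBall_lt_top).ne)
  · exact ((Complex.continuous_conj.comp (continuous_planeWave x)).measurable.indicator
      Metric.isClosed_closedBall.measurableSet).aestronglyMeasurable
  · refine Eventually.of_forall fun ξ => ?_
    by_cases h : ξ ∈ Metric.closedBall (0 : EuclideanSpace ℝ (Fin d)) N
    · rw [indicator_of_mem h, indicator_of_mem h, RCLike.norm_conj, norm_planeWave, norm_one]
    · rw [indicator_of_notMem h, indicator_of_notMem h, norm_zero, norm_zero]

/-- The truncated plane wave representing evaluation at `x` of functions with frequencies in the
ball `|ξ| ≤ N`. -/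
def waveLp (N : ℕ) (x : EuclideanSpace ℝ (Fin d)) : E2 d := (memLp_waveLp N x).toLp _

theorem norm_waveLp_sq_le (N : ℕ) (x : EuclideanSpace ℝ (Fin d)) :
    ‖waveLp N x‖ ^ 2 ≤ (N : ℝ) ^ d *
      (volume (Metric.ball (0 : EuclideanSpace ℝ (Fin d)) 1)).toReal := by
  have h := lintegral_enorm_sq_eq_norm_sq (waveLp N x)
  have h1 : ∫⁻ ξ, ‖waveLp N x ξ‖ₑ ^ 2 =
      volume (Metric.closedBall (0 : EuclideanSpace ℝ (Fin d)) N) := by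
    rw [← lintegral_indicator_one Metric.isClosed_closedBall.measurableSet]
    refine lintegral_congr_ae ?_
    filter_upwards [(memLp_waveLp N x).coeFn_toLp] with ξ hξ
    rw [waveLp, hξ]
    by_cases h : ξ ∈ Metric.closedBall (0 : EuclideanSpace ℝ (Fin d)) N
    · rw [indicator_of_mem h, indicator_of_mem h, ← ofReal_norm, RCLike.norm_conj, norm_planeWave]
      simp
    · rw [indicator_of_notMem h, indicator_of_notMem h]
      simp
  rw [h1, Measure.addHaar_closedBall _ _ (by positivity)] at h
  have h2 := congrArg ENNReal.toReal h
  rw [ENNReal.toReal_ofReal (by positivity), ENNReal.toReal_mul,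
    ENNReal.toReal_ofReal (by positivity), finrank_euclideanSpace_fin] at h2
  exact h2.ge

/-- Pairing with `waveLp N x` is the Fourier inversion integral at `x`. -/
theorem inner_waveLp (N : ℕ) (x : EuclideanSpace ℝ (Fin d)) (g : E2 d) :
    ⟪waveLp N x, g⟫_ℂ = 𝓕⁻ (cutL N g : EuclideanSpace ℝ (Fin d) → ℂ) x := by
  rw [fourierInv_eq_integral_planeWave, L2.inner_def]
  refine integral_congr_ae ?_
  filter_upwards [(memLp_waveLp N x).coeFn_toLp, coeFn_cutL N g] with ξ h1 h2
  rw [h2, waveLp, h1, RCLike.inner_apply]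
  by_cases h : ξ ∈ Metric.closedBall (0 : EuclideanSpace ℝ (Fin d)) N
  · simp only [indicator_of_mem h, RCLike.conj_conj, one_mul]
    rw [mul_comm]
  · simp only [indicator_of_notMem h, map_zero, mul_zero, zero_mul]

theorem integrable_cutL (N : ℕ) (g : E2 d) : Integrable (cutL N g) := by
  have h : Integrable ((Metric.closedBall (0 : EuclideanSpace ℝ (Fin d)) N).indicator g) := by
    rw [integrable_indicator_iff Metric.isClosed_closedBall.measurableSet]
    have : IsFiniteMeasure (volume.restrict (Metric.closedBall
        (0 : EuclideanSpace ℝ (Fin d)) N)) := ⟨by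
      rw [Measure.restrict_apply_univ]; exact measure_closedBall_lt_top⟩
    exact ((Lp.memLp g).restrict _).integrable (by norm_num)
  refine h.congr ?_
  filter_upwards [coeFn_cutL N g] with ξ hξ
  rw [hξ]
  by_cases h : ξ ∈ Metric.closedBall (0 : EuclideanSpace ℝ (Fin d)) N
  · rw [indicator_of_mem h, indicator_of_mem h, one_mul]
  · rw [indicator_of_notMem h, indicator_of_notMem h, zero_mul]

/-- Evaluation at `z` of the low-frequency part, as a bounded linear functional on `L²`. -/
def lowValL (N : ℕ) (z : Domain d m) : L2 d m →L[ℂ] ℂ :=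
  ∑ k ∈ cube m N, torusChar k z.2 • (innerSL ℂ (waveLp N z.1) ∘L modeL k)

theorem lowValL_apply (N : ℕ) (z : Domain d m) (u : L2 d m) :
    lowValL N z u = ∑ k ∈ cube m N, torusChar k z.2 * ⟪waveLp N z.1, fourierMode u k⟫_ℂ := by
  simp [lowValL]

theorem coeFn_lp_sum {X ι : Type*} [MeasurableSpace X] {μ : Measure X} (s : Finset ι)
    (f : ι → Lp ℂ 2 μ) : (∑ i ∈ s, f i : Lp ℂ 2 μ) =ᵐ[μ] fun x => ∑ i ∈ s, f i x := by
  classical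
  induction s using Finset.induction_on with
  | empty => exact Lp.coeFn_zero ℂ 2 μ
  | insert a s ha ih =>
    rw [Finset.sum_insert ha]
    filter_upwards [Lp.coeFn_add (f a) (∑ i ∈ s, f i), ih] with x h1 h2
    rw [h1, Pi.add_apply, h2, Finset.sum_insert ha]

/-- The low-frequency part is represented by its point values `lowValL`, by Fourier inversion. -/
theorem coeFn_lowPass (N : ℕ) (u : L2 d m) :
    lowPass N u =ᵐ[volume] fun z => lowValL N z u := by
  have h2 : ∀ k : Fin m → ℤ, ∀ᵐ z : Domain d m,
      tensor (𝓕⁻ (cutL N (fourierMode u k))) k z =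
        ⟪waveLp N z.1, fourierMode u k⟫_ℂ * torusChar k z.2 := by
    intro k
    have h3 := Measure.quasiMeasurePreserving_fst
      (μ := (volume : Measure (EuclideanSpace ℝ (Fin d)))) (ν := (volume : Measure (Torus m)))
      |>.ae_eq_comp (coeFn_fourierInv_of_integrable (integrable_cutL N (fourierMode u k)))
    filter_upwards [coeFn_tensor (𝓕⁻ (cutL N (fourierMode u k))) k, h3] with z h4 h5
    simp only [Function.comp_apply] at h5
    rw [h4, h5, inner_waveLp]
  filter_upwards [coeFn_lp_sum (cube m N) fun k => tensor (𝓕⁻ (cutL N (fourierMode u k))) k,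
    ae_all_iff.mpr h2] with z h3 h4
  rw [lowPass, h3, lowValL_apply]
  refine Finset.sum_congr rfl fun k _ => ?_
  rw [h4, mul_comm]

/-- The right-hand side does not depend on the torus variable `z.2`, so that only translations
along `ℝ^d` are needed later. -/
theorem norm_lowValL_le_sum (N : ℕ) (z : Domain d m) (u : L2 d m) :
    ‖lowValL N z u‖ ≤ ∑ k ∈ cube m N, ‖⟪waveLp N z.1, fourierMode u k⟫_ℂ‖ := by
  rw [lowValL_apply]
  refine (norm_sum_le _ _).trans (Finset.sum_le_sum fun k _ => ?_)
  rw [norm_mul, norm_torusChar, one_mul]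

/-- The value of a mode at `x` is the value at `0` of the mode of the translated function. -/
theorem inner_waveLp_eq_shift (N : ℕ) (x : EuclideanSpace ℝ (Fin d)) (u : L2 d m)
    (k : Fin m → ℤ) : ⟪waveLp N x, fourierMode u k⟫_ℂ =
      ⟪waveLp N 0, fourierMode (shiftL x u) k⟫_ℂ := by
  rw [fourierMode_shiftL, inner_waveLp, inner_waveLp, fourierInv_eq_integral_planeWave,
    fourierInv_eq_integral_planeWave]
  refine integral_congr_ae ?_
  filter_upwards [coeFn_cutL N (fourierMode u k), coeFn_cutL N (modulateL x (fourierMode u k)),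
    coeFn_modulateL x (fourierMode u k)] with ξ h1 h2 h3
  rw [h1, h2, h3]
  have : planeWave (0 : EuclideanSpace ℝ (Fin d)) ξ = 1 := by simp [planeWave]
  rw [this]
  ring

theorem sum_norm_fourierMode_sq_le (s : Finset (Fin m → ℤ)) (u : L2 d m) :
    ∑ k ∈ s, ‖fourierMode u k‖ ^ 2 ≤ ‖u‖ ^ 2 := by
  have h1 : (1 : ℝ) ≤ (2 * Real.pi) ^ m := one_le_pow₀ (by linarith [Real.pi_gt_three])
  refine le_trans (Finset.sum_le_sum fun k _ => ?_)
    (sum_le_hasSum s (fun k _ => mul_nonneg (zero_le_one.trans h1) (sq_nonneg _))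
      (hasSum_norm_sq_fourierMode u))
  exact le_mul_of_one_le_left (sq_nonneg _) h1

/-- Bernstein's inequality: band-limited functions are bounded, with the constant growing like
`N^{(d+m)/2}`. -/
theorem exists_norm_lowValL_le (d m : ℕ) : ∃ C : ℝ, 0 < C ∧ ∀ (N : ℕ), 1 ≤ N →
    ∀ (z : Domain d m) (u : L2 d m),
      ‖lowValL N z u‖ ≤ C * (N : ℝ) ^ (((d : ℝ) + m) / 2) * ‖u‖ := by
  obtain ⟨V, hV⟩ : ∃ V, V = (volume (Metric.ball (0 : EuclideanSpace ℝ (Fin d)) 1)).toReal :=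
    ⟨_, rfl⟩
  have hV0 : 0 ≤ V := hV ▸ ENNReal.toReal_nonneg
  refine ⟨Real.sqrt (V * 3 ^ m) + 1, by positivity, fun N hN z u => ?_⟩
  have hN1 : (1 : ℝ) ≤ N := by exact_mod_cast hN
  have hN0 : (0 : ℝ) < N := by linarith
  have h1 : ‖lowValL N z u‖ ≤ ∑ k ∈ cube m N, ‖waveLp N z.1‖ * ‖fourierMode u k‖ :=
    (norm_lowValL_le_sum N z u).trans (Finset.sum_le_sum fun k _ => norm_inner_le_norm _ _)
  have h2 := sum_norm_fourierMode_sq_le (cube m N) u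
  have h3 : (∑ k ∈ cube m N, ‖waveLp N z.1‖ * ‖fourierMode u k‖) ^ 2 ≤
      (V * 3 ^ m) * ((N : ℝ) ^ d * (N : ℝ) ^ m) * ‖u‖ ^ 2 := by
    have h4 : ‖waveLp N z.1‖ ^ 2 ≤ (N : ℝ) ^ d * V := hV ▸ norm_waveLp_sq_le N z.1
    have h5 : (((2 * N + 1) ^ m : ℕ) : ℝ) ≤ 3 ^ m * (N : ℝ) ^ m := by
      rw [← mul_pow]
      push_cast
      gcongr
      linarith
    have h7 : ∑ k ∈ cube m N, ‖waveLp N z.1‖ ^ 2 ≤ 3 ^ m * (N : ℝ) ^ m * ((N : ℝ) ^ d * V) := by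
      rw [Finset.sum_const, card_cube, nsmul_eq_mul]
      exact mul_le_mul h5 h4 (sq_nonneg _) (by positivity)
    calc _ ≤ (∑ k ∈ cube m N, ‖waveLp N z.1‖ ^ 2) * ∑ k ∈ cube m N, ‖fourierMode u k‖ ^ 2 :=
          Finset.sum_mul_sq_le_sq_mul_sq _ _ _
      _ ≤ (3 ^ m * (N : ℝ) ^ m * ((N : ℝ) ^ d * V)) * ‖u‖ ^ 2 :=
          mul_le_mul h7 h2 (Finset.sum_nonneg fun _ _ => sq_nonneg _) (by positivity)
      _ = _ := by ring
  have h6 : ((N : ℝ) ^ (((d : ℝ) + m) / 2)) ^ 2 = (N : ℝ) ^ d * (N : ℝ) ^ m := by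
    rw [← Real.rpow_natCast, ← Real.rpow_mul hN0.le, ← pow_add, ← Real.rpow_natCast]
    congr 1
    push_cast
    ring
  refine h1.trans (le_trans ?_ (show Real.sqrt (V * 3 ^ m) * (N : ℝ) ^ (((d : ℝ) + m) / 2) * ‖u‖
    ≤ _ by gcongr; linarith))
  refine le_of_sq_le_sq ?_ (by positivity)
  rw [mul_pow, mul_pow, h6, Real.sq_sqrt (by positivity)]
  exact h3

/-! ### The Sobolev inequality -/

/-- Interpolation of the `L^p` norm between `L²` and `L^∞`. -/
theorem eLpNorm_le_of_ae_bound {X : Type*} [MeasurableSpace X] {μ : Measure X} {p M : ℝ}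
    (hp : 2 < p) (hM : 0 ≤ M) (v : Lp ℂ 2 μ) (h : ∀ᵐ z ∂μ, ‖v z‖ ≤ M) :
    eLpNorm v (ENNReal.ofReal p) μ ≤ ENNReal.ofReal (M ^ (1 - 2 / p) * ‖v‖ ^ (2 / p)) := by
  have hp0 : 0 < p := by linarith
  rw [eLpNorm_eq_lintegral_rpow_enorm_toReal (by simpa using hp0) ENNReal.ofReal_ne_top,
    ENNReal.toReal_ofReal hp0.le]
  have h1 : ∫⁻ z, ‖v z‖ₑ ^ p ∂μ ≤ ENNReal.ofReal (M ^ (p - 2) * ‖v‖ ^ 2) := by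
    rw [ENNReal.ofReal_mul (by positivity), ← lintegral_enorm_sq_eq_norm_sq,
      ← lintegral_const_mul' _ _ ENNReal.ofReal_ne_top]
    refine lintegral_mono_ae ?_
    filter_upwards [h] with z hz
    rw [← ofReal_norm, ENNReal.ofReal_rpow_of_nonneg (norm_nonneg _) hp0.le,
      ← ENNReal.ofReal_pow (norm_nonneg _), ← ENNReal.ofReal_mul (by positivity)]
    refine ENNReal.ofReal_le_ofReal ?_
    calc ‖v z‖ ^ p = ‖v z‖ ^ (p - 2) * ‖v z‖ ^ 2 := by
          rw [← Real.rpow_natCast, ← Real.rpow_add_of_nonneg (norm_nonneg _) (by linarith)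
            (by positivity)]
          congr 1
          push_cast
          ring
      _ ≤ _ := by gcongr
  calc (∫⁻ z, ‖v z‖ₑ ^ p ∂μ) ^ (1 / p) ≤ ENNReal.ofReal (M ^ (p - 2) * ‖v‖ ^ 2) ^ (1 / p) :=
        ENNReal.rpow_le_rpow h1 (by positivity)
    _ = _ := by
        rw [ENNReal.ofReal_rpow_of_nonneg (by positivity) (by positivity),
          Real.mul_rpow (by positivity) (by positivity), ← Real.rpow_mul hM,
          ← Real.rpow_natCast, ← Real.rpow_mul (norm_nonneg _)]
        congr 3
        · field_simp
        · push_cast; ring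

theorem eLpNorm_lowPass_le {p M : ℝ} (hp : 2 < p) (hM : 0 ≤ M) {N : ℕ} {u : L2 d m}
    (h : ∀ z, ‖lowValL N z u‖ ≤ M) :
    eLpNorm (lowPass N u) (ENNReal.ofReal p) volume ≤
      ENNReal.ofReal (M ^ (1 - 2 / p) * ‖u‖ ^ (2 / p)) := by
  refine (eLpNorm_le_of_ae_bound hp hM (lowPass N u) ?_).trans (ENNReal.ofReal_le_ofReal ?_)
  · filter_upwards [coeFn_lowPass N u] with z hz
    rw [hz]
    exact h z
  · have := norm_lowPass_le N u
    gcongr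

/-- Convergence of the dyadic frequency cut-offs in `L²`. -/
theorem tendsto_lowPass {σ : ℝ} (hσ : 0 < σ) {u w : L2 d m} (h : IsFracLaplacian (σ / 2) u w) :
    Tendsto (fun n : ℕ => lowPass (2 ^ n) u) atTop (𝓝 u) := by
  rw [tendsto_iff_norm_sub_tendsto_zero]
  have h1 : Tendsto (fun n : ℕ => (((2 : ℝ) ^ (-σ)) ^ n) * ‖w‖) atTop (𝓝 (0 * ‖w‖)) :=
    (tendsto_pow_atTop_nhds_zero_of_lt_one (by positivity)
      (Real.rpow_lt_one_of_one_lt_of_neg (by norm_num) (by linarith))).mul_const _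
  rw [zero_mul] at h1
  refine squeeze_zero (fun _ => norm_nonneg _) (fun n => ?_) h1
  rw [norm_sub_rev]
  refine (norm_sub_lowPass_le hσ Nat.one_le_two_pow h).trans (le_of_eq ?_)
  push_cast
  rw [← Real.rpow_natCast, ← Real.rpow_mul (by norm_num), ← Real.rpow_natCast,
    ← Real.rpow_mul (by norm_num), mul_comm (n : ℝ)]

/-- One dyadic block in `L^p`: interpolate between the `L²` decay `2^{-jσ}` and Bernstein's
inequality. -/
theorem exists_eLpNorm_block_le (d m : ℕ) {σ p : ℝ} (hσ : 0 < σ) (hp : 2 < p) :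
    ∃ C : ℝ, 0 < C ∧ ∀ (u w : L2 d m), IsFracLaplacian (σ / 2) u w → ∀ j : ℕ,
      eLpNorm (lowPass (2 ^ (j + 1)) u - lowPass (2 ^ j) u : L2 d m) (ENNReal.ofReal p) volume ≤
        ENNReal.ofReal
          (C * ((2 : ℝ) ^ (((d : ℝ) + m) / 2 * (1 - 2 / p) - σ)) ^ j * ‖w‖) := by
  obtain ⟨C, hC0, hC⟩ := exists_norm_lowValL_le d m
  set D : ℝ := ((d : ℝ) + m) / 2 with hD
  refine ⟨(C * 2 ^ D) ^ (1 - 2 / p), by positivity, fun u w h j => ?_⟩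
  set v : L2 d m := u - lowPass (2 ^ j) u with hv
  have hv1 : ‖v‖ ≤ ((2 : ℝ) ^ j) ^ (-σ) * ‖w‖ := by
    have := norm_sub_lowPass_le hσ (N := 2 ^ j) Nat.one_le_two_pow h
    push_cast at this
    exact this
  have e1 : lowPass (2 ^ (j + 1)) u - lowPass (2 ^ j) u = lowPass (2 ^ (j + 1)) v := by
    rw [hv, lowPass_sub, lowPass_lowPass (Nat.pow_le_pow_right (by norm_num) (Nat.le_succ j))]
  rw [e1]
  have h2 : ∀ z, ‖lowValL (2 ^ (j + 1)) z v‖ ≤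
      C * ((2 : ℝ) ^ (j + 1)) ^ D * (((2 : ℝ) ^ j) ^ (-σ) * ‖w‖) := by
    intro z
    have := hC (2 ^ (j + 1)) Nat.one_le_two_pow z v
    push_cast at this
    exact this.trans (by gcongr)
  refine (eLpNorm_lowPass_le hp (by positivity) h2).trans (ENNReal.ofReal_le_ofReal ?_)
  have hq : (0 : ℝ) ≤ 2 / p := by positivity
  have hr : (0 : ℝ) ≤ 1 - 2 / p := by
    rw [sub_nonneg, div_le_one (by linarith)]; exact hp.le
  set W : ℝ := ((2 : ℝ) ^ j) ^ (-σ) * ‖w‖ with hW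
  have hW0 : 0 ≤ W := by positivity
  have e2 : ((2 : ℝ) ^ (j + 1)) ^ D = 2 ^ D * ((2 : ℝ) ^ j) ^ D := by
    rw [pow_succ, mul_comm, Real.mul_rpow (by norm_num) (by positivity)]
  have e3 : W ^ (1 - 2 / p) * W ^ (2 / p) = W := by
    rw [← Real.rpow_add_of_nonneg hW0 hr hq, sub_add_cancel, Real.rpow_one]
  calc (C * ((2 : ℝ) ^ (j + 1)) ^ D * W) ^ (1 - 2 / p) * ‖v‖ ^ (2 / p)
      ≤ (C * ((2 : ℝ) ^ (j + 1)) ^ D * W) ^ (1 - 2 / p) * W ^ (2 / p) := by gcongr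
    _ = (C * 2 ^ D) ^ (1 - 2 / p) * (((2 : ℝ) ^ j) ^ D) ^ (1 - 2 / p) *
          (W ^ (1 - 2 / p) * W ^ (2 / p)) := by
        rw [e2, ← mul_assoc C, Real.mul_rpow (by positivity) hW0,
          Real.mul_rpow (by positivity) (by positivity)]
        ring
    _ = (C * 2 ^ D) ^ (1 - 2 / p) *
          ((((2 : ℝ) ^ j) ^ D) ^ (1 - 2 / p) * ((2 : ℝ) ^ j) ^ (-σ)) * ‖w‖ := by
        rw [e3, hW]; ring
    _ ≤ _ := by
        refine le_of_eq ?_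
        congr 2
        rw [← Real.rpow_mul (by positivity), ← Real.rpow_add (by positivity),
          ← Real.rpow_natCast, ← Real.rpow_mul (by positivity), ← Real.rpow_natCast,
          ← Real.rpow_mul (by positivity)]
        congr 1
        ring

/-- In the subcritical range the dyadic blocks form a convergent geometric series in `L^p`; so the
high frequencies of a bounded subset of `H^σ` are uniformly small in `L^p`. -/
theorem exists_eLpNorm_sub_lowPass_le (d m : ℕ) {σ p : ℝ} (hσ : 0 < σ) (hp : 2 < p)
    (hsub : ((d : ℝ) + m) / 2 * (1 - 2 / p) < σ) :
    ∃ C ρ : ℝ, 0 < C ∧ 0 < ρ ∧ ρ < 1 ∧ ∀ (u w : L2 d m), IsFracLaplacian (σ / 2) u w → ∀ J : ℕ,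
      eLpNorm (u - lowPass (2 ^ J) u : L2 d m) (ENNReal.ofReal p) volume ≤
        ENNReal.ofReal (C * ρ ^ J * ‖w‖) := by
  obtain ⟨C, hC0, hC⟩ := exists_eLpNorm_block_le d m hσ hp
  set ρ : ℝ := (2 : ℝ) ^ (((d : ℝ) + m) / 2 * (1 - 2 / p) - σ) with hρ
  have hρ0 : 0 < ρ := by positivity
  have hρ1 : ρ < 1 := Real.rpow_lt_one_of_one_lt_of_neg (by norm_num) (by linarith)
  have hp1 : 1 ≤ ENNReal.ofReal p := by
    rw [← ENNReal.ofReal_one]; exact ENNReal.ofReal_le_ofReal (by linarith)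
  have h1ρ : 0 < 1 - ρ := by linarith
  refine ⟨C / (1 - ρ), ρ, by positivity, hρ0, hρ1, fun u w h J => ?_⟩
  -- partial sums of the dyadic series
  have key : ∀ n : ℕ, eLpNorm (lowPass (2 ^ (J + n)) u - lowPass (2 ^ J) u : L2 d m)
      (ENNReal.ofReal p) volume ≤
        ENNReal.ofReal (C / (1 - ρ) * (ρ ^ J - ρ ^ (J + n)) * ‖w‖) := by
    intro n
    induction n with
    | zero =>
      rw [add_zero, sub_self, eLpNorm_congr_ae (Lp.coeFn_zero ℂ 2 volume), eLpNorm_zero]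
      exact zero_le
    | succ n ih =>
      have e : lowPass (2 ^ (J + (n + 1))) u - lowPass (2 ^ J) u =
          (lowPass (2 ^ (J + n + 1)) u - lowPass (2 ^ (J + n)) u) +
            (lowPass (2 ^ (J + n)) u - lowPass (2 ^ J) u) := by
        rw [sub_add_sub_cancel, add_assoc]
      rw [e, eLpNorm_congr_ae (Lp.coeFn_add _ _)]
      refine (eLpNorm_add_le (Lp.aestronglyMeasurable _) (Lp.aestronglyMeasurable _) hp1).trans ?_
      refine (add_le_add (hC u w h (J + n)) ih).trans ?_
      have hpow : ρ ^ (J + n) ≤ ρ ^ J := pow_le_pow_of_le_one hρ0.le hρ1.le (Nat.le_add_right _ _)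
      have h5 : 0 ≤ ρ ^ J - ρ ^ (J + n) := by linarith
      rw [← ENNReal.ofReal_add (by positivity) (by positivity)]
      refine ENNReal.ofReal_le_ofReal (le_of_eq ?_)
      rw [← add_assoc, pow_succ]
      field_simp
      ring
  have hlim : Tendsto (fun n : ℕ => lowPass (2 ^ (J + n)) u) atTop (𝓝 u) := by
    have := (tendsto_add_atTop_iff_nat J).mpr (tendsto_lowPass hσ h)
    simpa only [add_comm] using this
  have hmeas : TendstoInMeasure volume
      (fun n => ((lowPass (2 ^ (J + n)) u : L2 d m) : Domain d m → ℂ)) atTop u :=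
    tendstoInMeasure_of_tendsto_Lp hlim
  obtain ⟨ns, -, hns⟩ := hmeas.exists_seq_tendsto_ae
  have hns' : ∀ᵐ z : Domain d m, Tendsto (fun i =>
      (lowPass (2 ^ (J + ns i)) u - lowPass (2 ^ J) u : L2 d m) z) atTop
      (𝓝 ((u - lowPass (2 ^ J) u : L2 d m) z)) := by
    filter_upwards [hns, Lp.coeFn_sub u (lowPass (2 ^ J) u), ae_all_iff.mpr fun i =>
      Lp.coeFn_sub (lowPass (2 ^ (J + ns i)) u) (lowPass (2 ^ J) u)] with z h1 h2 h3
    simp_rw [h2, h3, Pi.sub_apply]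
    exact h1.sub_const _
  refine (Lp.eLpNorm_lim_le_liminf_eLpNorm (fun i => Lp.aestronglyMeasurable _) _ hns').trans ?_
  refine (liminf_le_liminf (Eventually.of_forall fun i => ?_)).trans
    (liminf_const (f := (atTop : Filter ℕ)) (ENNReal.ofReal (C / (1 - ρ) * ρ ^ J * ‖w‖))).le
  refine (key (ns i)).trans (ENNReal.ofReal_le_ofReal ?_)
  gcongr
  linarith [pow_pos hρ0 (J + ns i)]

/-- The Sobolev inequality `‖u‖_p ≤ C (‖(-Δ)^{σ/2} u‖₂ + ‖u‖₂)` in the subcritical range. -/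
theorem exists_eLpNorm_le_sobolev (d m : ℕ) {σ p : ℝ} (hσ : 0 < σ) (hp : 2 < p)
    (hsub : ((d : ℝ) + m) / 2 * (1 - 2 / p) < σ) :
    ∃ C : ℝ, 0 < C ∧ ∀ (u w : L2 d m), IsFracLaplacian (σ / 2) u w →
      eLpNorm u (ENNReal.ofReal p) volume ≤ ENNReal.ofReal (C * (‖w‖ + ‖u‖)) := by
  obtain ⟨C, ρ, hC0, -, -, hC⟩ := exists_eLpNorm_sub_lowPass_le d m hσ hp hsub
  obtain ⟨C', hC0', hC'⟩ := exists_norm_lowValL_le d m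
  have hp1 : 1 ≤ ENNReal.ofReal p := by
    rw [← ENNReal.ofReal_one]; exact ENNReal.ofReal_le_ofReal (by linarith)
  have hq : (0 : ℝ) ≤ 2 / p := by positivity
  have hr : (0 : ℝ) ≤ 1 - 2 / p := by
    rw [sub_nonneg, div_le_one (by linarith)]; exact hp.le
  refine ⟨C + C' ^ (1 - 2 / p), by positivity, fun u w h => ?_⟩
  have h1 := hC u w h 0
  rw [pow_zero, pow_zero, mul_one] at h1
  have h2 : eLpNorm (lowPass 1 u) (ENNReal.ofReal p) volume ≤
      ENNReal.ofReal (C' ^ (1 - 2 / p) * ‖u‖) := by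
    refine (eLpNorm_lowPass_le hp (M := C' * ‖u‖) (by positivity) fun z => ?_).trans
      (ENNReal.ofReal_le_ofReal (le_of_eq ?_))
    · have := hC' 1 le_rfl z u
      rwa [Nat.cast_one, Real.one_rpow, mul_one] at this
    · rw [Real.mul_rpow hC0'.le (norm_nonneg _), mul_assoc,
        ← Real.rpow_add_of_nonneg (norm_nonneg _) hr hq, sub_add_cancel, Real.rpow_one]
  have e : u = (u - lowPass 1 u) + lowPass 1 u := (sub_add_cancel _ _).symm
  calc eLpNorm u (ENNReal.ofReal p) volume
      = eLpNorm ((u - lowPass 1 u : L2 d m) + lowPass 1 u : L2 d m) (ENNReal.ofReal p) volume := by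
        rw [← e]
    _ ≤ _ := by
        rw [eLpNorm_congr_ae (Lp.coeFn_add _ _)]
        exact eLpNorm_add_le (Lp.aestronglyMeasurable _) (Lp.aestronglyMeasurable _) hp1
    _ ≤ ENNReal.ofReal (C * ‖w‖) + ENNReal.ofReal (C' ^ (1 - 2 / p) * ‖u‖) := add_le_add h1 h2
    _ ≤ _ := by
        rw [← ENNReal.ofReal_add (by positivity) (by positivity)]
        refine ENNReal.ofReal_le_ofReal ?_
        have h3 : 0 ≤ C * ‖u‖ := by positivity
        have h4 : 0 ≤ C' ^ (1 - 2 / p) * ‖w‖ := by positivity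
        nlinarith

/-! ### The Sobolev space and the fractional Laplacian -/

section FracLaplacian

variable {s σ : ℝ} {u v w w' : L2 d m}

theorem IsFracLaplacian.unique (h : IsFracLaplacian s u w) (h' : IsFracLaplacian s u w') :
    w = w' := by
  refine ext_fourierMode fun k => Lp.ext ?_
  filter_upwards [h k, h' k] with ξ h1 h2
  rw [h1, h2]

theorem IsFracLaplacian.add (h : IsFracLaplacian s u w) (h' : IsFracLaplacian s v w') :
    IsFracLaplacian s (u + v) (w + w') := by
  intro k
  rw [← modeL_apply, ← modeL_apply, map_add, map_add]
  filter_upwards [h k, h' k, Lp.coeFn_add (modeL k w) (modeL k w'),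
    Lp.coeFn_add (modeL k u) (modeL k v)] with ξ h1 h2 h3 h4
  rw [h3, h4, Pi.add_apply, Pi.add_apply, modeL_apply, modeL_apply, h1, h2, modeL_apply,
    modeL_apply, mul_add]

theorem IsFracLaplacian.smul (c : ℂ) (h : IsFracLaplacian s u w) :
    IsFracLaplacian s (c • u) (c • w) := by
  intro k
  rw [← modeL_apply, ← modeL_apply, map_smul, map_smul]
  filter_upwards [h k, Lp.coeFn_smul c (modeL k w), Lp.coeFn_smul c (modeL k u)] with ξ h1 h3 h4
  rw [h3, h4, Pi.smul_apply, Pi.smul_apply, modeL_apply, h1, modeL_apply, smul_eq_mul,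
    smul_eq_mul, mul_left_comm]

theorem IsFracLaplacian.sub (h : IsFracLaplacian s u w) (h' : IsFracLaplacian s v w') :
    IsFracLaplacian s (u - v) (w - w') := by
  have := h.add (h'.smul (-1))
  simpa only [neg_smul, one_smul, ← sub_eq_add_neg] using this

theorem IsFracLaplacian.shift (a : EuclideanSpace ℝ (Fin d)) (h : IsFracLaplacian s u w) :
    IsFracLaplacian s (shiftL a u) (shiftL a w) := by
  intro k
  rw [fourierMode_shiftL, fourierMode_shiftL]
  filter_upwards [h k, coeFn_modulateL a (fourierMode u k), coeFn_modulateL a (fourierMode w k)]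
    with ξ h1 h2 h3
  rw [h2, h3, h1, mul_left_comm]

theorem IsFracLaplacian.fracLaplacian_eq (h : IsFracLaplacian s u w) : fracLaplacian s u = w := by
  have hex : ∃ w : L2 d m, IsFracLaplacian s u w := ⟨w, h⟩
  rw [fracLaplacian, dif_pos hex]
  exact hex.choose_spec.unique h

theorem IsFracLaplacian.mem_sobolev (h : IsFracLaplacian (σ / 2) u w) : u ∈ Sobolev d m σ := ⟨w, h⟩

theorem isFracLaplacian_of_mem (h : u ∈ Sobolev d m σ) :
    IsFracLaplacian (σ / 2) u (fracLaplacian (σ / 2) u) := by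
  obtain ⟨w, hw⟩ := h
  rwa [hw.fracLaplacian_eq]

/-- The symbol of `(-Δ)^s` restricted to `|ξ| ≤ N`, normalised to be bounded by `1`. -/
def symbolCut (s : ℝ) (N : ℕ) (k : Fin m → ℤ) (ξ : EuclideanSpace ℝ (Fin d)) : ℂ :=
  (Metric.closedBall (0 : EuclideanSpace ℝ (Fin d)) N).indicator (fun ξ =>
    ((laplaceSymbol ξ k ^ s / (((2 * Real.pi * N) ^ 2 + ∑ i, (k i : ℝ) ^ 2) ^ s + 1) : ℝ) : ℂ)) ξ

theorem measurable_symbolCut (s : ℝ) (N : ℕ) (k : Fin m → ℤ) :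
    Measurable (symbolCut (d := d) s N k) := by
  refine Measurable.indicator ?_ Metric.isClosed_closedBall.measurableSet
  unfold laplaceSymbol
  fun_prop

theorem norm_symbolCut_le (hs : 0 ≤ s) (N : ℕ) (k : Fin m → ℤ) (ξ : EuclideanSpace ℝ (Fin d)) :
    ‖symbolCut s N k ξ‖ ≤ 1 := by
  unfold symbolCut
  by_cases hξ : ξ ∈ Metric.closedBall (0 : EuclideanSpace ℝ (Fin d)) N
  · have h0 := laplaceSymbol_nonneg ξ k
    rw [indicator_of_mem hξ, Complex.norm_real, Real.norm_of_nonneg (by positivity),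
      div_le_one (by positivity)]
    have h1 : laplaceSymbol ξ k ≤ (2 * Real.pi * N) ^ 2 + ∑ i, (k i : ℝ) ^ 2 := by
      have : ‖ξ‖ ≤ N := by simpa using hξ
      unfold laplaceSymbol
      gcongr
    have h2 := Real.rpow_le_rpow h0 h1 hs
    linarith
  · rw [indicator_of_notMem hξ, norm_zero]
    exact zero_le_one

/-- The graph of `(-Δ)^s` is weakly closed: on each ball of frequencies the symbol is bounded, so
membership in the graph is an identity between bounded operators. -/
theorem IsFracLaplacian.of_weak_limit (hs : 0 ≤ s) {U W : ℕ → L2 d m}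
    (h : ∀ n, IsFracLaplacian s (U n) (W n))
    (hU : ∀ f : L2 d m →L[ℂ] ℂ, Tendsto (fun n => f (U n)) atTop (𝓝 (f u)))
    (hW : ∀ f : L2 d m →L[ℂ] ℂ, Tendsto (fun n => f (W n)) atTop (𝓝 (f w))) :
    IsFracLaplacian s u w := by
  intro k
  have key : ∀ N : ℕ, ∀ᵐ ξ : EuclideanSpace ℝ (Fin d),
      ξ ∈ Metric.closedBall (0 : EuclideanSpace ℝ (Fin d)) N →
      fourierMode w k ξ = ((laplaceSymbol ξ k ^ s : ℝ) : ℂ) * fourierMode u k ξ := by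
    intro N
    set K : ℝ := ((2 * Real.pi * N) ^ 2 + ∑ i, (k i : ℝ) ^ 2) ^ s + 1 with hK
    have hK0 : K ≠ 0 := by positivity
    set A : L2 d m →L[ℂ] E2 d :=
      mulL (symbolCut s N k) (measurable_symbolCut s N k) (norm_symbolCut_le hs N k) ∘L modeL k
      with hA
    set B : L2 d m →L[ℂ] E2 d := (K : ℂ)⁻¹ • (cutL N ∘L modeL k) with hB
    have hAu : ∀ u, A u =ᵐ[volume] fun ξ => symbolCut s N k ξ * fourierMode u k ξ :=
      fun u => coeFn_mulL (measurable_symbolCut s N k) (norm_symbolCut_le hs N k) _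
    have hBu : ∀ u, B u =ᵐ[volume] fun ξ => (K : ℂ)⁻¹ *
        ((Metric.closedBall (0 : EuclideanSpace ℝ (Fin d)) N).indicator (fun _ => (1 : ℂ)) ξ *
          fourierMode u k ξ) := by
      intro u
      filter_upwards [Lp.coeFn_smul (K : ℂ)⁻¹ (cutL N (fourierMode u k)),
        coeFn_cutL N (fourierMode u k)] with ξ h1 h2
      rw [← h2]
      exact h1
    have h1 : ∀ n, A (U n) = B (W n) := by
      intro n
      refine Lp.ext ?_
      filter_upwards [hAu (U n), hBu (W n), h n k] with ξ h1 h2 h3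
      rw [h1, h2, h3, symbolCut]
      by_cases hξ : ξ ∈ Metric.closedBall (0 : EuclideanSpace ℝ (Fin d)) N
      · rw [indicator_of_mem hξ, indicator_of_mem hξ, ← hK, Complex.ofReal_div]
        ring
      · rw [indicator_of_notMem hξ, indicator_of_notMem hξ]
        ring
    have h2 : A u = B w := by
      refine ext_inner_left ℂ fun g => ?_
      have h3 := hU (innerSL ℂ g ∘L A)
      have h4 := hW (innerSL ℂ g ∘L B)
      simp only [ContinuousLinearMap.comp_apply, h1] at h3
      simp only [ContinuousLinearMap.comp_apply] at h4
      simpa using tendsto_nhds_unique h3 h4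
    filter_upwards [hAu u, hBu w] with ξ h3 h4 hξ
    rw [← h2, h3, symbolCut, indicator_of_mem hξ, indicator_of_mem hξ, one_mul] at h4
    have hKc : (K : ℂ) ≠ 0 := by exact_mod_cast hK0
    rw [eq_inv_mul_iff_mul_eq₀ hKc] at h4
    rw [← h4, ← mul_assoc, ← Complex.ofReal_mul, ← hK, mul_div_cancel₀ _ hK0]
  filter_upwards [ae_all_iff.mpr key] with ξ hξ
  -- the balls `|ξ| ≤ N` exhaust `ℝ^d`
  obtain ⟨N, hN⟩ := exists_nat_ge ‖ξ‖
  exact hξ N (by simpa using hN)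

/-- `H^σ` contains a nonzero function. -/
theorem exists_mem_sobolev_ne_zero (d m : ℕ) {σ : ℝ} (hσ : 0 < σ) :
    ∃ u ∈ Sobolev d m σ, u ≠ 0 := by
  have hms : MeasurableSet (Metric.closedBall (0 : EuclideanSpace ℝ (Fin d)) (1 : ℕ)) :=
    Metric.isClosed_closedBall.measurableSet
  set g : E2 d := indicatorConstLp 2 hms (measure_closedBall_lt_top).ne (1 : ℂ) with hg
  have hgv : g =ᵐ[volume] (Metric.closedBall (0 : EuclideanSpace ℝ (Fin d)) (1 : ℕ)).indicator
      fun _ => (1 : ℂ) := indicatorConstLp_coeFn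
  have hg0 : g ≠ 0 := by
    rw [← norm_ne_zero_iff, hg, norm_indicatorConstLp (by norm_num) (by norm_num)]
    have : 0 < (volume : Measure (EuclideanSpace ℝ (Fin d))).real
        (Metric.closedBall 0 (1 : ℕ)) :=
      ENNReal.toReal_pos (Metric.measure_closedBall_pos _ _ (by norm_num)).ne'
        (measure_closedBall_lt_top).ne
    exact mul_ne_zero (by norm_num) (Real.rpow_pos_of_pos this _).ne'
  set K : ℝ := ((2 * Real.pi * (1 : ℕ)) ^ 2 + ∑ i, (((0 : Fin m → ℤ) i : ℤ) : ℝ) ^ 2) ^ (σ / 2) + 1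
    with hK
  have hK0 : K ≠ 0 := by positivity
  have hs : 0 ≤ σ / 2 := by linarith
  set h : E2 d := (K : ℂ) • mulL (symbolCut (σ / 2) 1 (0 : Fin m → ℤ)) (measurable_symbolCut _ _ _)
    (norm_symbolCut_le hs _ _) g with hh
  refine ⟨tensor (𝓕⁻ g) 0, ⟨tensor (𝓕⁻ h) 0, fun k => ?_⟩, fun h0 => hg0 ?_⟩
  · rw [fourierMode_tensor, fourierMode_tensor]
    split_ifs with hk
    · rw [FourierTransform.fourier_fourierInv_eq, FourierTransform.fourier_fourierInv_eq]
      filter_upwards [Lp.coeFn_smul (K : ℂ) (mulL (symbolCut (σ / 2) 1 (0 : Fin m → ℤ))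
        (measurable_symbolCut _ _ _) (norm_symbolCut_le hs _ _) g),
        coeFn_mulL (measurable_symbolCut _ _ _) (norm_symbolCut_le hs _ (0 : Fin m → ℤ)) g, hgv]
        with ξ h1 h2 h3
      rw [hh, h1, Pi.smul_apply, h2, h3, symbolCut, smul_eq_mul, hk]
      by_cases hξ : ξ ∈ Metric.closedBall (0 : EuclideanSpace ℝ (Fin d)) (1 : ℕ)
      · rw [indicator_of_mem hξ, indicator_of_mem hξ, mul_one, mul_one, ← Complex.ofReal_mul,
          ← hK, mul_div_cancel₀ _ hK0]
      · rw [indicator_of_notMem hξ, indicator_of_notMem hξ]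
        ring
    · filter_upwards [Lp.coeFn_zero ℂ 2 (volume : Measure (EuclideanSpace ℝ (Fin d)))] with ξ h1
      rw [h1]
      simp
  · have h1 : fourierMode (tensor (𝓕⁻ g) (0 : Fin m → ℤ)) 0 = 0 := by
      rw [h0, ← modeL_apply, map_zero]
    rwa [fourierMode_tensor, if_pos rfl, FourierTransform.fourier_fourierInv_eq] at h1

end FracLaplacian

/-! ### Weak compactness and the Brezis–Lieb inequality -/

/-- Bounded sequences in a separable Hilbert space have weakly convergent subsequences. -/
theorem exists_weak_limit {H : Type*} [NormedAddCommGroup H] [InnerProductSpace ℂ H]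
    [CompleteSpace H] [TopologicalSpace.SeparableSpace H] {x : ℕ → H} {B : ℝ}
    (hx : ∀ n, ‖x n‖ ≤ B) : ∃ a : H, ∃ φ : ℕ → ℕ, StrictMono φ ∧
      ∀ f : H →L[ℂ] ℂ, Tendsto (fun n => f (x (φ n))) atTop (𝓝 (f a)) := by
  obtain ⟨a, -, φ, hφ, h⟩ := WeakDual.isSeqCompact_closedBall ℂ H 0 B
    (x := fun n => StrongDual.toWeakDual (InnerProductSpace.toDual ℂ H (x n))) (fun n => by
      simpa using hx n)
  refine ⟨(InnerProductSpace.toDual ℂ H).symm (WeakDual.toStrongDual a), φ, hφ, fun f => ?_⟩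
  obtain ⟨g, rfl⟩ := (InnerProductSpace.toDual ℂ H).surjective f
  have h1 := (WeakBilin.tendsto_iff_forall_eval_tendsto _
    (ContinuousLinearMap.coe_injective)).mp h g
  have h2 := (Complex.continuous_conj.tendsto _).comp h1
  have e : ∀ y : H, (InnerProductSpace.toDual ℂ H g) y =
      (starRingEnd ℂ) (InnerProductSpace.toDual ℂ H y g) := by
    intro y
    simp
  simp only [e, LinearIsometryEquiv.apply_symm_apply]
  exact h2

theorem rpow_norm_add_le {p ε : ℝ} (hp : 1 < p) (hε : 0 < ε) :
    ∃ C : ℝ, 0 < C ∧ ∀ a b : ℂ, ‖a + b‖ ^ p ≤ (1 + ε) * ‖a‖ ^ p + C * ‖b‖ ^ p := by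
  -- choose `t < 1` with `t * (t⁻¹)^p = 1 + ε`, and use convexity of `x ↦ x ^ p`
  set t : ℝ := (1 + ε) ^ (-(1 / (p - 1))) with ht
  have hp1 : 0 < p - 1 := by linarith
  have ht0 : 0 < t := by positivity
  have ht1 : t < 1 := Real.rpow_lt_one_of_one_lt_of_neg (by linarith) (by
    rw [neg_lt_zero]; positivity)
  have h1t : 0 < 1 - t := by linarith
  have e1 : t * t⁻¹ ^ p = 1 + ε := by
    rw [Real.inv_rpow ht0.le, ← Real.rpow_neg ht0.le]
    nth_rewrite 1 [← Real.rpow_one t]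
    rw [← Real.rpow_add ht0, ht, ← Real.rpow_mul (by linarith)]
    have : -(1 / (p - 1)) * (1 + -p) = 1 := by field_simp; ring
    rw [this, Real.rpow_one]
  refine ⟨(1 - t) * (1 - t)⁻¹ ^ p, by positivity, fun a b => ?_⟩
  have hconv := (convexOn_rpow hp.le).2 (x := t⁻¹ * ‖a‖) (y := (1 - t)⁻¹ * ‖b‖)
    (show _ ∈ Ici (0 : ℝ) from by simp only [mem_Ici]; positivity)
    (show _ ∈ Ici (0 : ℝ) from by simp only [mem_Ici]; positivity)
    ht0.le h1t.le (by ring)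
  simp only [smul_eq_mul] at hconv
  rw [mul_inv_cancel_left₀ ht0.ne', mul_inv_cancel_left₀ h1t.ne',
    Real.mul_rpow (by positivity) (norm_nonneg _), Real.mul_rpow (by positivity) (norm_nonneg _),
    ← mul_assoc, ← mul_assoc, e1] at hconv
  exact (Real.rpow_le_rpow (norm_nonneg _) (norm_add_le a b) (by linarith)).trans hconv

/-- The one-sided Brezis–Lieb inequality: along an a.e. convergent sequence bounded in `L^p`, the
`p`-th powers of the limit and of the remainder asymptotically account for all of the mass. -/
theorem eventually_integral_rpow_le {X : Type*} [MeasurableSpace X] {μ : Measure X} {p M : ℝ}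
    (hp : 1 < p) {W : ℕ → X → ℂ} {f : X → ℂ}
    (hWm : ∀ n, AEStronglyMeasurable (W n) μ) (hfm : AEStronglyMeasurable f μ)
    (hW : ∀ n, Integrable (fun z => ‖W n z‖ ^ p) μ) (hf : Integrable (fun z => ‖f z‖ ^ p) μ)
    (hM : ∀ n, ∫ z, ‖W n z‖ ^ p ∂μ ≤ M)
    (hlim : ∀ᵐ z ∂μ, Tendsto (fun n => W n z) atTop (𝓝 0)) {η : ℝ} (hη : 0 < η) :
    ∀ᶠ n in atTop, ∫ z, ‖W n z + f z‖ ^ p ∂μ ≤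
      ∫ z, ‖W n z‖ ^ p ∂μ + ∫ z, ‖f z‖ ^ p ∂μ + η := by
  have hp0 : 0 < p := by linarith
  have hM0 : 0 ≤ M := (integral_nonneg fun z => by positivity).trans (hM 0)
  set ε : ℝ := η / (2 * (M + 1)) with hεdef
  have hε : 0 < ε := by positivity
  obtain ⟨C, hC0, hC⟩ := rpow_norm_add_le hp hε
  set G : ℕ → X → ℝ := fun n z =>
    max (‖W n z + f z‖ ^ p - (1 + ε) * ‖W n z‖ ^ p - ‖f z‖ ^ p) 0 with hG
  have hpm : ∀ {g : X → ℂ}, AEStronglyMeasurable g μ →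
      AEStronglyMeasurable (fun z => ‖g z‖ ^ p) μ := fun hg =>
    (hg.norm.aemeasurable.pow_const p).aestronglyMeasurable
  have hGm : ∀ n, AEStronglyMeasurable (G n) μ := fun n =>
    ((((hpm ((hWm n).add hfm)).aemeasurable.sub
      ((hpm (hWm n)).aemeasurable.const_mul (1 + ε))).sub
      (hpm hfm).aemeasurable).max aemeasurable_const).aestronglyMeasurable
  have hGb : ∀ n, ∀ᵐ z ∂μ, ‖G n z‖ ≤ C * ‖f z‖ ^ p := by
    intro n
    refine Eventually.of_forall fun z => ?_
    rw [hG, Real.norm_of_nonneg (le_max_right _ _)]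
    refine max_le ?_ (by positivity)
    have h1 := hC (W n z) (f z)
    have h2 : 0 ≤ ‖f z‖ ^ p := by positivity
    linarith
  have hGlim : ∀ᵐ z ∂μ, Tendsto (fun n => G n z) atTop (𝓝 0) := by
    filter_upwards [hlim] with z hz
    have hc : ∀ c : ℂ, Tendsto (fun n => ‖W n z + c‖ ^ p) atTop (𝓝 (‖c‖ ^ p)) := by
      intro c
      have := ((hz.add_const c).norm).rpow_const (p := p) (Or.inr hp0.le)
      rwa [zero_add] at this
    have h0 := hc 0
    simp only [add_zero, norm_zero, Real.zero_rpow hp0.ne'] at h0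
    have h3 := (((hc (f z)).sub (h0.const_mul (1 + ε))).sub_const (‖f z‖ ^ p)).max
      (tendsto_const_nhds (x := (0 : ℝ)))
    simpa using h3
  have hGi : ∀ n, Integrable (G n) μ := fun n =>
    Integrable.mono' (hf.const_mul C) (hGm n) (hGb n)
  have hDCT := tendsto_integral_of_dominated_convergence (fun z => C * ‖f z‖ ^ p) hGm
    (hf.const_mul C) hGb hGlim
  rw [integral_zero] at hDCT
  filter_upwards [hDCT.eventually_lt_const (show 0 < η / 2 by positivity)] with n hn
  have h4 : ∫ z, ‖W n z + f z‖ ^ p ∂μ ≤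
      ∫ z, ((1 + ε) * ‖W n z‖ ^ p + ‖f z‖ ^ p + G n z) ∂μ := by
    refine integral_mono_of_nonneg (Eventually.of_forall fun z => by positivity)
      ((((hW n).const_mul _).add hf).add (hGi n)) (Eventually.of_forall fun z => ?_)
    have := le_max_left (‖W n z + f z‖ ^ p - (1 + ε) * ‖W n z‖ ^ p - ‖f z‖ ^ p) 0
    simp only [hG]
    linarith
  have h6 := integral_add (f := fun z => (1 + ε) * ‖W n z‖ ^ p + ‖f z‖ ^ p)
    (((hW n).const_mul _).add hf) (hGi n)
  have h7 := integral_add (f := fun z => (1 + ε) * ‖W n z‖ ^ p) ((hW n).const_mul _) hf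
  rw [h6, h7, integral_const_mul] at h4
  have h5 : ε * ∫ z, ‖W n z‖ ^ p ∂μ ≤ η / 2 := by
    calc ε * ∫ z, ‖W n z‖ ^ p ∂μ ≤ ε * (M + 1) := by
          gcongr; linarith [hM n]
      _ = η / 2 := by rw [hεdef]; field_simp
  linarith

/-! ### Compactness in the Sobolev space -/

theorem separableSpace_L2 (d m : ℕ) : TopologicalSpace.SeparableSpace (L2 d m) := by
  have h3 : MeasurableSpace.CountablyGenerated (Domain d m) := inferInstance
  have : IsSeparable (volume : Measure (Domain d m)) :=
    @instIsSeparableOfCountablyGeneratedOfSFinite _ _ _ h3 _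
  have : Fact ((2 : ℝ≥0∞) ≠ ∞) := ⟨by norm_num⟩
  infer_instance

/-- A sequence bounded in `H^σ` and bounded below in a subcritical `L^p` has, after suitable
translations along `ℝ^d`, a nonzero weak limit. Indeed the high frequencies are uniformly small in
`L^p`, so some fixed low-frequency part is bounded below in `L^p`, hence by interpolation in
`L^∞`; and its point values are continuous for weak convergence. -/
theorem exists_shifted_weak_limit {σ p : ℝ} (hσ : 0 < σ) (hp : 2 < p)
    (hsub : ((d : ℝ) + m) / 2 * (1 - 2 / p) < σ) {U W : ℕ → L2 d m} {B c : ℝ} (hc : 0 < c)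
    (hUW : ∀ n, IsFracLaplacian (σ / 2) (U n) (W n)) (hU : ∀ n, ‖U n‖ ≤ B) (hW : ∀ n, ‖W n‖ ≤ B)
    (hlow : ∀ n, ENNReal.ofReal c ≤ eLpNorm (U n) (ENNReal.ofReal p) volume) :
    ∃ (a : ℕ → EuclideanSpace ℝ (Fin d)) (φ : ℕ → ℕ) (u w : L2 d m), StrictMono φ ∧ u ≠ 0 ∧
      IsFracLaplacian (σ / 2) u w ∧
      (∀ f : L2 d m →L[ℂ] ℂ,
        Tendsto (fun n => f (shiftL (a (φ n)) (U (φ n)))) atTop (𝓝 (f u))) ∧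
      ∀ f : L2 d m →L[ℂ] ℂ,
        Tendsto (fun n => f (shiftL (a (φ n)) (W (φ n)))) atTop (𝓝 (f w)) := by
  have := separableSpace_L2 d m
  have hB : 0 ≤ B := (norm_nonneg _).trans (hU 0)
  have hp1 : 1 ≤ ENNReal.ofReal p := by
    rw [← ENNReal.ofReal_one]; exact ENNReal.ofReal_le_ofReal (by linarith)
  have hr : (0 : ℝ) < 1 - 2 / p := by
    rw [sub_pos, div_lt_one (by linarith)]; exact hp
  obtain ⟨C, ρ, hC0, hρ0, hρ1, hC⟩ := exists_eLpNorm_sub_lowPass_le d m hσ hp hsub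
  -- a frequency scale beyond which the `L^p` mass is at most `c / 4`
  obtain ⟨J, hJ⟩ : ∃ J : ℕ, C * ρ ^ J * B < c / 4 := by
    have h1 : Tendsto (fun J : ℕ => C * ρ ^ J * B) atTop (𝓝 (C * 0 * B)) :=
      ((tendsto_pow_atTop_nhds_zero_of_lt_one hρ0.le hρ1).const_mul C).mul_const B
    rw [mul_zero, zero_mul] at h1
    exact (h1.eventually_lt_const (by positivity)).exists
  have h2 : ∀ n, ENNReal.ofReal (c / 2) < eLpNorm (lowPass (2 ^ J) (U n))
      (ENNReal.ofReal p) volume := by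
    intro n
    by_contra! hcon
    have e : U n = (U n - lowPass (2 ^ J) (U n)) + lowPass (2 ^ J) (U n) :=
      (sub_add_cancel _ _).symm
    have h3 : eLpNorm (U n) (ENNReal.ofReal p) volume ≤
        ENNReal.ofReal (c / 4) + ENNReal.ofReal (c / 2) := by
      calc eLpNorm (U n) (ENNReal.ofReal p) volume
          = eLpNorm ((U n - lowPass (2 ^ J) (U n) : L2 d m) + lowPass (2 ^ J) (U n) : L2 d m)
              (ENNReal.ofReal p) volume := by rw [← e]
        _ ≤ eLpNorm (U n - lowPass (2 ^ J) (U n) : L2 d m) (ENNReal.ofReal p) volume +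
              eLpNorm (lowPass (2 ^ J) (U n)) (ENNReal.ofReal p) volume := by
            rw [eLpNorm_congr_ae (Lp.coeFn_add _ _)]
            exact eLpNorm_add_le (Lp.aestronglyMeasurable _) (Lp.aestronglyMeasurable _) hp1
        _ ≤ _ := by
            refine add_le_add ((hC _ _ (hUW n) J).trans (ENNReal.ofReal_le_ofReal ?_)) hcon
            exact (mul_le_mul_of_nonneg_left (hW n) (by positivity)).trans hJ.le
    rw [← ENNReal.ofReal_add (by positivity) (by positivity)] at h3
    have h4 := (ENNReal.ofReal_le_ofReal_iff (by positivity)).mp ((hlow n).trans h3)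
    linarith
  obtain ⟨δ, hδ0, hδ⟩ : ∃ δ : ℝ, 0 < δ ∧ δ ^ (1 - 2 / p) * B ^ (2 / p) ≤ c / 2 := by
    have h1 : Tendsto (fun δ : ℝ => δ ^ (1 - 2 / p) * B ^ (2 / p)) (𝓝[>] 0)
        (𝓝 ((0 : ℝ) ^ (1 - 2 / p) * B ^ (2 / p))) :=
      (((Real.continuousAt_rpow_const 0 (1 - 2 / p) (Or.inr hr.le)).tendsto).mono_left
        nhdsWithin_le_nhds).mul_const _
    rw [Real.zero_rpow hr.ne', zero_mul] at h1
    obtain ⟨δ, h3, h4⟩ := ((h1.eventually_lt_const (show 0 < c / 2 by positivity)).and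
      self_mem_nhdsWithin).exists
    exact ⟨δ, h4, h3.le⟩
  have h3 : ∀ n, ∃ z : Domain d m, δ < ‖lowValL (2 ^ J) z (U n)‖ := by
    intro n
    by_contra! hcon
    refine absurd (h2 n) (not_lt.mpr ?_)
    refine (eLpNorm_lowPass_le hp hδ0.le hcon).trans (ENNReal.ofReal_le_ofReal ?_)
    refine le_trans ?_ hδ
    have := hU n
    gcongr
  choose z hz using h3
  obtain ⟨u, φ₁, hφ₁, hu⟩ := exists_weak_limit (x := fun n => shiftL (z n).1 (U n)) (B := B)
    (fun n => by rw [LinearIsometry.norm_map]; exact hU n)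
  obtain ⟨w, φ₂, hφ₂, hw⟩ := exists_weak_limit
    (x := fun n => shiftL (z (φ₁ n)).1 (W (φ₁ n))) (B := B)
    (fun n => by rw [LinearIsometry.norm_map]; exact hW _)
  have hu' : ∀ f : L2 d m →L[ℂ] ℂ, Tendsto
      (fun n => f (shiftL (z (φ₁ (φ₂ n))).1 (U (φ₁ (φ₂ n))))) atTop (𝓝 (f u)) :=
    fun f => (hu f).comp hφ₂.tendsto_atTop
  refine ⟨fun n => (z n).1, φ₁ ∘ φ₂, u, w, hφ₁.comp hφ₂, ?_, ?_, hu', hw⟩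
  · rintro rfl
    have h4 : Tendsto (fun n => ∑ k ∈ cube m (2 ^ J), ‖⟪waveLp (2 ^ J) 0,
        fourierMode (shiftL (z (φ₁ (φ₂ n))).1 (U (φ₁ (φ₂ n)))) k⟫_ℂ‖) atTop (𝓝 0) := by
      have h5 := tendsto_finsetSum (cube m (2 ^ J)) fun k _ =>
        (hu' (innerSL ℂ (waveLp (2 ^ J) 0) ∘L modeL k)).norm
      have h6 : ∀ k : Fin m → ℤ, fourierMode (0 : L2 d m) k = 0 := fun k => (modeL k).map_zero
      simpa [h6] using h5
    obtain ⟨n, hn⟩ := (h4.eventually_lt_const hδ0).exists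
    refine absurd (hz (φ₁ (φ₂ n))) (not_lt.mpr ?_)
    refine (norm_lowValL_le_sum _ _ _).trans (le_trans (le_of_eq ?_) hn.le)
    exact Finset.sum_congr rfl fun k _ => by rw [inner_waveLp_eq_shift]
  · exact IsFracLaplacian.of_weak_limit (by linarith) (fun n => (hUW (φ₁ (φ₂ n))).shift _) hu' hw

/-- A sequence bounded in `H^σ` and weakly convergent to `0` tends to `0` almost everywhere along a
subsequence: its low-frequency parts tend to `0` pointwise, and the high frequencies are uniformly
small in `L²`. -/
theorem exists_subseq_ae_tendsto_zero {σ : ℝ} (hσ : 0 < σ) {V W : ℕ → L2 d m} {B : ℝ}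
    (hVW : ∀ n, IsFracLaplacian (σ / 2) (V n) (W n)) (hV : ∀ n, ‖V n‖ ≤ B) (hW : ∀ n, ‖W n‖ ≤ B)
    (hlim : ∀ f : L2 d m →L[ℂ] ℂ, Tendsto (fun n => f (V n)) atTop (𝓝 0)) :
    ∃ φ : ℕ → ℕ, StrictMono φ ∧ ∀ᵐ z, Tendsto (fun n => V (φ n) z) atTop (𝓝 0) := by
  have hB : 0 ≤ B := (norm_nonneg _).trans (hV 0)
  -- a finite measure with the same null sets as `volume`
  obtain ⟨g, hg0, hgm, hgi⟩ := exists_pos_lintegral_lt_of_sigmaFinite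
    (volume : Measure (Domain d m)) one_ne_zero
  set κ : Domain d m → ℝ≥0∞ := fun z => min (g z : ℝ≥0∞) 1 with hκ
  have hκm : Measurable κ := hgm.coe_nnreal_ennreal.min measurable_const
  set μ : Measure (Domain d m) := volume.withDensity κ with hμ
  have hμle : μ ≤ volume := by
    refine (withDensity_mono (Eventually.of_forall fun z => min_le_right _ _)).trans (le_of_eq ?_)
    exact withDensity_one
  have hμfin : IsFiniteMeasure μ := by
    refine ⟨?_⟩
    rw [hμ, withDensity_apply _ MeasurableSet.univ, Measure.restrict_univ]
    exact (lintegral_mono fun z => min_le_left _ _).trans_lt (hgi.trans ENNReal.one_lt_top)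
  have hac : (volume : Measure (Domain d m)) ≪ μ :=
    withDensity_absolutelyContinuous' hκm.aemeasurable (Eventually.of_forall fun z =>
      (lt_min (by exact_mod_cast hg0 z) one_pos).ne')
  have hac' : μ ≪ volume := withDensity_absolutelyContinuous _ _
  obtain ⟨C, hC0, hC⟩ := exists_norm_lowValL_le d m
  have hlowm : ∀ J n, AEStronglyMeasurable (fun z => lowValL (2 ^ J) z (V n)) μ := fun J n =>
    ((Lp.aestronglyMeasurable (lowPass (2 ^ J) (V n))).mono_ac hac').congr
      (hac'.ae_le (coeFn_lowPass (2 ^ J) (V n)))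
  have hlow : ∀ J : ℕ, Tendsto (fun n => eLpNorm (fun z => lowValL (2 ^ J) z (V n)) 2 μ) atTop
      (𝓝 0) := by
    intro J
    have hb : ∀ n z, ‖lowValL (2 ^ J) z (V n)‖ₑ ^ 2 ≤
        ENNReal.ofReal (C * ((2 ^ J : ℕ) : ℝ) ^ (((d : ℝ) + m) / 2) * B) ^ 2 := by
      intro n z
      rw [← ofReal_norm]
      gcongr
      refine (hC (2 ^ J) Nat.one_le_two_pow z (V n)).trans ?_
      have := hV n
      gcongr
    have h1 := tendsto_lintegral_of_dominated_convergence' (μ := μ)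
      (F := fun n z => ‖lowValL (2 ^ J) z (V n)‖ₑ ^ 2) (f := fun _ => 0)
      (fun _ => ENNReal.ofReal (C * ((2 ^ J : ℕ) : ℝ) ^ (((d : ℝ) + m) / 2) * B) ^ 2)
      (fun n => (hlowm J n).enorm.pow_const 2) (fun n => Eventually.of_forall (hb n))
      (by
        rw [lintegral_const]
        exact ENNReal.mul_ne_top (ENNReal.pow_ne_top ENNReal.ofReal_ne_top) (measure_ne_top _ _))
      (Eventually.of_forall fun z => by
        have h2 := ENNReal.Tendsto.pow (n := 2) (hlim (lowValL (2 ^ J) z)).enorm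
        simpa using h2)
    rw [lintegral_zero] at h1
    have h3 := (ENNReal.continuous_rpow_const (y := 1 / 2)).tendsto 0 |>.comp h1
    rw [ENNReal.zero_rpow_of_pos (by norm_num)] at h3
    refine h3.congr fun n => ?_
    rw [eLpNorm_eq_lintegral_rpow_enorm_toReal (by norm_num) (by norm_num)]
    simp
  have hV0 : Tendsto (fun n => eLpNorm (V n) 2 μ) atTop (𝓝 0) := by
    rw [ENNReal.tendsto_atTop_zero]
    intro ε hε
    obtain ⟨δ, hδ0, hδε⟩ : ∃ δ : ℝ, 0 < δ ∧ ENNReal.ofReal δ ≤ ε := by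
      rcases eq_or_ne ε ∞ with rfl | hne
      · exact ⟨1, one_pos, le_top⟩
      · exact ⟨ε.toReal, ENNReal.toReal_pos hε.ne' hne, (ENNReal.ofReal_toReal hne).le⟩
    obtain ⟨J, hJ⟩ : ∃ J : ℕ, ((2 : ℝ) ^ (-σ)) ^ J * B < δ / 2 := by
      have h1 : Tendsto (fun n : ℕ => (((2 : ℝ) ^ (-σ)) ^ n) * B) atTop (𝓝 (0 * B)) :=
        (tendsto_pow_atTop_nhds_zero_of_lt_one (by positivity)
          (Real.rpow_lt_one_of_one_lt_of_neg (by norm_num) (by linarith))).mul_const _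
      rw [zero_mul] at h1
      exact (h1.eventually_lt_const (by positivity)).exists
    obtain ⟨n₀, hn₀⟩ := (ENNReal.tendsto_atTop_zero.mp (hlow J)) (ENNReal.ofReal (δ / 2))
      (by simpa using hδ0)
    refine ⟨n₀, fun n hn => le_trans ?_ hδε⟩
    have h2 : ‖V n - lowPass (2 ^ J) (V n)‖ ≤ δ / 2 := by
      have h3 := norm_sub_lowPass_le hσ (N := 2 ^ J) Nat.one_le_two_pow (hVW n)
      push_cast at h3
      refine h3.trans (le_trans ?_ hJ.le)
      rw [← Real.rpow_natCast, ← Real.rpow_mul (by norm_num), ← Real.rpow_natCast,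
        ← Real.rpow_mul (by norm_num), mul_comm (J : ℝ)]
      exact mul_le_mul_of_nonneg_left (hW n) (by positivity)
    have h4 : eLpNorm (V n - lowPass (2 ^ J) (V n) : L2 d m) 2 μ ≤ ENNReal.ofReal (δ / 2) := by
      refine (eLpNorm_mono_measure _ hμle).trans ?_
      rw [← ENNReal.ofReal_toReal (Lp.memLp (V n - lowPass (2 ^ J) (V n))).2.ne, ← Lp.norm_def]
      exact ENNReal.ofReal_le_ofReal h2
    have h5 : V n =ᵐ[μ] ((V n - lowPass (2 ^ J) (V n) : L2 d m) : Domain d m → ℂ) +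
        fun z => lowValL (2 ^ J) z (V n) := by
      filter_upwards [hac'.ae_le (coeFn_lowPass (2 ^ J) (V n)),
        hac'.ae_le (Lp.coeFn_sub (V n) (lowPass (2 ^ J) (V n)))] with z h6 h7
      rw [Pi.add_apply, h7, Pi.sub_apply, h6, sub_add_cancel]
    rw [eLpNorm_congr_ae h5]
    refine (eLpNorm_add_le ((Lp.aestronglyMeasurable _).mono_ac hac') (hlowm J n)
      (by norm_num)).trans ?_
    refine (add_le_add h4 (hn₀ n hn)).trans (le_of_eq ?_)
    rw [← ENNReal.ofReal_add (by positivity) (by positivity), add_halves]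
  have hmeas : TendstoInMeasure μ (fun n => (V n : Domain d m → ℂ)) atTop (fun _ => 0) := by
    refine tendstoInMeasure_of_tendsto_eLpNorm (p := 2) (by norm_num)
      (fun n => (Lp.aestronglyMeasurable _).mono_ac hac') aestronglyMeasurable_const ?_
    refine hV0.congr fun n => ?_
    congr 1
    ext z
    simp
  obtain ⟨φ, hφ, h⟩ := hmeas.exists_seq_tendsto_ae
  exact ⟨φ, hφ, hac.ae_le h⟩

/-! ### The minimisation problem -/

section Functionals

variable {σ ω p : ℝ} {u v : L2 d m}

theorem fracLaplacian_add (hu : u ∈ Sobolev d m σ) (hv : v ∈ Sobolev d m σ) :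
    fracLaplacian (σ / 2) (u + v) = fracLaplacian (σ / 2) u + fracLaplacian (σ / 2) v :=
  ((isFracLaplacian_of_mem hu).add (isFracLaplacian_of_mem hv)).fracLaplacian_eq

theorem fracLaplacian_smul (c : ℂ) (hu : u ∈ Sobolev d m σ) :
    fracLaplacian (σ / 2) (c • u) = c • fracLaplacian (σ / 2) u :=
  ((isFracLaplacian_of_mem hu).smul c).fracLaplacian_eq

theorem add_mem_sobolev (hu : u ∈ Sobolev d m σ) (hv : v ∈ Sobolev d m σ) :
    u + v ∈ Sobolev d m σ :=
  ((isFracLaplacian_of_mem hu).add (isFracLaplacian_of_mem hv)).mem_sobolev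

theorem smul_mem_sobolev (c : ℂ) (hu : u ∈ Sobolev d m σ) : c • u ∈ Sobolev d m σ :=
  ((isFracLaplacian_of_mem hu).smul c).mem_sobolev

/-- The quadratic form `‖(-Δ)^{σ/2}u‖₂² + ω‖u‖₂²`. -/
def quad (σ ω : ℝ) (u : L2 d m) : ℝ := ‖fracLaplacian (σ / 2) u‖ ^ 2 + ω * ‖u‖ ^ 2

/-- The functional `‖u‖_p^p`. -/
def power (p : ℝ) (u : L2 d m) : ℝ := ∫ z, ‖u z‖ ^ p

theorem quad_nonneg (hω : 0 ≤ ω) (u : L2 d m) : 0 ≤ quad σ ω u := by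
  unfold quad; positivity

theorem power_nonneg (p : ℝ) (u : L2 d m) : 0 ≤ power p u :=
  integral_nonneg fun z => by positivity

theorem quad_smul (c : ℂ) (hu : u ∈ Sobolev d m σ) :
    quad σ ω (c • u) = ‖c‖ ^ 2 * quad σ ω u := by
  rw [quad, quad, fracLaplacian_smul c hu, norm_smul, norm_smul]
  ring

theorem power_smul (p : ℝ) (c : ℂ) (u : L2 d m) : power p (c • u) = ‖c‖ ^ p * power p u := by
  rw [power, power, ← integral_const_mul]
  refine integral_congr_ae ?_
  filter_upwards [Lp.coeFn_smul c u] with z hz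
  rw [hz, Pi.smul_apply, smul_eq_mul, norm_mul, Real.mul_rpow (norm_nonneg _) (norm_nonneg _)]

theorem power_shiftL (p : ℝ) (a : EuclideanSpace ℝ (Fin d)) (u : L2 d m) :
    power p (shiftL a u) = power p u := by
  have hmp := measurePreserving_shift (d := d) (m := m) a
  have h1 : ∫ z, ‖u z‖ ^ p = ∫ z : Domain d m, ‖u (z.1 + a, z.2)‖ ^ p := by
    have h2 := integral_map (μ := (volume : Measure (Domain d m))) hmp.aemeasurable
      (f := fun z => ‖u z‖ ^ p) (by
        rw [hmp.map_eq]
        exact ((Lp.aestronglyMeasurable u).norm.aemeasurable.pow_const p).aestronglyMeasurable)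
    rwa [hmp.map_eq] at h2
  rw [power, power, h1]
  refine integral_congr_ae ?_
  filter_upwards [coeFn_shiftL a u] with z hz
  rw [hz]

theorem quad_shiftL (a : EuclideanSpace ℝ (Fin d)) (hu : u ∈ Sobolev d m σ) :
    quad σ ω (shiftL a u) = quad σ ω u := by
  rw [quad, quad, ((isFracLaplacian_of_mem hu).shift a).fracLaplacian_eq, LinearIsometry.norm_map,
    LinearIsometry.norm_map]

theorem quad_pos (hω : 0 < ω) (hu : u ≠ 0) : 0 < quad σ ω u := by
  have := norm_pos_iff.mpr hu
  unfold quad; positivity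

theorem memLp_of_mem_sobolev (hσ : 0 < σ) (hp : 2 < p)
    (hsub : ((d : ℝ) + m) / 2 * (1 - 2 / p) < σ) (hu : u ∈ Sobolev d m σ) :
    MemLp u (ENNReal.ofReal p) volume := by
  obtain ⟨C, -, hC⟩ := exists_eLpNorm_le_sobolev d m hσ hp hsub
  exact ⟨Lp.aestronglyMeasurable u,
    (hC u _ (isFracLaplacian_of_mem hu)).trans_lt ENNReal.ofReal_lt_top⟩

theorem eLpNorm_eq_power (hp : 2 < p) (hu : MemLp u (ENNReal.ofReal p) volume) :
    eLpNorm u (ENNReal.ofReal p) volume = ENNReal.ofReal (power p u ^ (1 / p)) := by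
  have hp0 : 0 < p := by linarith
  rw [hu.eLpNorm_eq_integral_rpow_norm (by simpa using hp0) ENNReal.ofReal_ne_top,
    ENNReal.toReal_ofReal hp0.le, power, one_div]

theorem integrable_rpow_norm {X : Type*} [MeasurableSpace X] {μ : Measure X} {f : X → ℂ}
    (hp : 2 < p) (hu : MemLp f (ENNReal.ofReal p) μ) :
    Integrable (fun z => ‖f z‖ ^ p) μ := by
  have hp0 : 0 < p := by linarith
  have := hu.integrable_norm_rpow (by simpa using hp0) ENNReal.ofReal_ne_top
  rwa [ENNReal.toReal_ofReal hp0.le] at this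

theorem power_pos (hp : 2 < p) (hu : MemLp u (ENNReal.ofReal p) volume) (h0 : u ≠ 0) :
    0 < power p u := by
  refine lt_of_le_of_ne (power_nonneg p u) fun h => h0 ?_
  rw [power, eq_comm, integral_eq_zero_iff_of_nonneg (fun z => by positivity)
    (integrable_rpow_norm hp hu)] at h
  rw [Lp.eq_zero_iff_ae_eq_zero]
  filter_upwards [h] with z hz
  have h1 := (Real.rpow_eq_zero (norm_nonneg _) (by linarith)).mp hz
  simpa using h1

/-- The Sobolev inequality in terms of the quadratic form. -/
theorem exists_power_le_quad (d m : ℕ) (hσ : 0 < σ) (hp : 2 < p)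
    (hsub : ((d : ℝ) + m) / 2 * (1 - 2 / p) < σ) (hω : 0 < ω) :
    ∃ C : ℝ, 0 < C ∧ ∀ u ∈ Sobolev d m σ, power p u ^ (2 / p) ≤ C * quad σ ω u := by
  obtain ⟨C, hC0, hC⟩ := exists_eLpNorm_le_sobolev d m hσ hp hsub
  have hp0 : 0 < p := by linarith
  refine ⟨C ^ 2 * (2 * (1 + 1 / ω)), by positivity, fun u hu => ?_⟩
  have h1 := hC u _ (isFracLaplacian_of_mem hu)
  rw [eLpNorm_eq_power hp (memLp_of_mem_sobolev hσ hp hsub hu),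
    ENNReal.ofReal_le_ofReal_iff (by positivity)] at h1
  have h2 : power p u ^ (2 / p) = (power p u ^ (1 / p)) ^ 2 := by
    rw [← Real.rpow_natCast, ← Real.rpow_mul (power_nonneg p u)]
    congr 1
    push_cast
    ring
  rw [h2]
  refine (pow_le_pow_left₀ (Real.rpow_nonneg (power_nonneg p u) _) h1 2).trans ?_
  rw [mul_pow, quad, mul_assoc]
  refine mul_le_mul_of_nonneg_left ?_ (by positivity)
  set t := ‖fracLaplacian (σ / 2) u‖
  set s := ‖u‖
  have h3 : 0 ≤ 1 / ω * t ^ 2 := by positivity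
  have h4 : 0 ≤ ω * s ^ 2 := by positivity
  have h5 : 1 / ω * (ω * s ^ 2) = s ^ 2 := by field_simp
  nlinarith [sq_nonneg (t - s)]

end Functionals

/-- Polarisation along a weakly convergent sequence: `‖x_n‖² - ‖x_n - a‖² → ‖a‖²`. -/
theorem tendsto_norm_sq_sub {H : Type*} [NormedAddCommGroup H] [InnerProductSpace ℂ H]
    {x : ℕ → H} {a : H} (h : ∀ f : H →L[ℂ] ℂ, Tendsto (fun n => f (x n)) atTop (𝓝 (f a))) :
    Tendsto (fun n => ‖x n‖ ^ 2 - ‖x n - a‖ ^ 2) atTop (𝓝 (‖a‖ ^ 2)) := by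
  have h1 := (Complex.continuous_re.tendsto _).comp (h (innerSL ℂ a))
  have h2 := (h1.const_mul 2).sub_const (‖a‖ ^ 2)
  have e : ∀ y : H, ‖y‖ ^ 2 - ‖y - a‖ ^ 2 = 2 * (⟪a, y⟫_ℂ).re - ‖a‖ ^ 2 := by
    intro y
    have h3 := @norm_sub_sq ℂ _ _ _ _ a y
    rw [norm_sub_rev] at h3
    rw [h3]
    simp only [RCLike.re_to_complex]
    ring
  simp only [e]
  have h4 : 2 * (⟪a, a⟫_ℂ).re - ‖a‖ ^ 2 = ‖a‖ ^ 2 := by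
    have := @inner_self_eq_norm_sq ℂ _ _ _ _ a
    simp only [RCLike.re_to_complex] at this
    rw [this]
    ring
  have h5 := h2
  simp only [Function.comp_def, innerSL_apply_apply] at h5
  rwa [h4] at h5

/-- The best constant in `S ‖u‖_p² ≤ ‖(-Δ)^{σ/2}u‖₂² + ω‖u‖₂²`, `u ∈ H^σ(ℝ^d × 𝕋^m)`. -/
def bestConst (d m : ℕ) (σ p ω : ℝ) : ℝ :=
  sInf (quad σ ω '' {u : L2 d m | u ∈ Sobolev d m σ ∧ power p u = 1})

section BestConst

variable {σ p ω : ℝ}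

theorem exists_normalized (hp : 2 < p) {v : L2 d m} (hv : v ∈ Sobolev d m σ)
    (hpos : 0 < power p v) : ∃ v' ∈ Sobolev d m σ, power p v' = 1 ∧
      quad σ ω v = power p v ^ (2 / p) * quad σ ω v' := by
  have hp0 : 0 < p := by linarith
  set c : ℝ := power p v ^ (-(1 / p)) with hc
  have hc0 : 0 < c := by positivity
  refine ⟨(c : ℂ) • v, smul_mem_sobolev _ hv, ?_, ?_⟩
  · rw [power_smul, Complex.norm_real, Real.norm_of_nonneg hc0.le, hc, ← Real.rpow_mul hpos.le]
    have : -(1 / p) * p = -1 := by field_simp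
    rw [this, Real.rpow_neg_one, inv_mul_cancel₀ hpos.ne']
  · rw [quad_smul _ hv, Complex.norm_real, Real.norm_of_nonneg hc0.le, ← mul_assoc, hc,
      ← Real.rpow_natCast, ← Real.rpow_mul hpos.le, ← Real.rpow_add hpos]
    have : 2 / p + -(1 / p) * ((2 : ℕ) : ℝ) = 0 := by push_cast; ring
    rw [this, Real.rpow_zero, one_mul]

theorem bddBelow_quad_image (hω : 0 < ω) (s : Set (L2 d m)) : BddBelow (quad σ ω '' s) :=
  ⟨0, by rintro _ ⟨v, -, rfl⟩; exact quad_nonneg hω.le v⟩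

theorem nonempty_quad_image (hσ : 0 < σ) (hp : 2 < p)
    (hsub : ((d : ℝ) + m) / 2 * (1 - 2 / p) < σ) :
    (quad σ ω '' {u : L2 d m | u ∈ Sobolev d m σ ∧ power p u = 1}).Nonempty := by
  obtain ⟨v, hv, hv0⟩ := exists_mem_sobolev_ne_zero d m hσ
  obtain ⟨v', hv', h1, -⟩ := exists_normalized (ω := ω) hp hv
    (power_pos hp (memLp_of_mem_sobolev hσ hp hsub hv) hv0)
  exact ⟨_, v', ⟨hv', h1⟩, rfl⟩

theorem bestConst_mul_le (hp : 2 < p) (hω : 0 < ω) {v : L2 d m} (hv : v ∈ Sobolev d m σ) :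
    bestConst d m σ p ω * power p v ^ (2 / p) ≤ quad σ ω v := by
  have hp0 : 0 < p := by linarith
  rcases (power_nonneg p v).eq_or_lt with h0 | hpos
  · rw [← h0, Real.zero_rpow (by positivity), mul_zero]
    exact quad_nonneg hω.le v
  · obtain ⟨v', hv', h1, h2⟩ := exists_normalized (ω := ω) hp hv hpos
    rw [h2, mul_comm]
    exact mul_le_mul_of_nonneg_left (csInf_le (bddBelow_quad_image hω _) ⟨v', ⟨hv', h1⟩, rfl⟩)
      (by positivity)

theorem bestConst_pos (hσ : 0 < σ) (hp : 2 < p) (hsub : ((d : ℝ) + m) / 2 * (1 - 2 / p) < σ)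
    (hω : 0 < ω) : 0 < bestConst d m σ p ω := by
  obtain ⟨C, hC0, hC⟩ := exists_power_le_quad d m hσ hp hsub hω
  have : 1 / C ≤ bestConst d m σ p ω := by
    refine le_csInf (nonempty_quad_image hσ hp hsub) ?_
    rintro _ ⟨v, ⟨hv, h1⟩, rfl⟩
    have := hC v hv
    rw [h1, Real.one_rpow] at this
    rwa [div_le_iff₀' hC0]
  exact lt_of_lt_of_le (by positivity) this

/-- The best constant is attained. By the Brezis–Lieb inequality and polarisation, the mass of a
translated minimising sequence splits between its weak limit `u ≠ 0` and a remainder; as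
`a^{2/p} + b^{2/p} > a + b` for `a, b ∈ (0, 1)`, all of the mass is in `u`. -/
theorem isLeast_bestConst (hσ : 0 < σ) (hp : 2 < p)
    (hsub : ((d : ℝ) + m) / 2 * (1 - 2 / p) < σ) (hω : 0 < ω) :
    IsLeast (quad σ ω '' {u : L2 d m | u ∈ Sobolev d m σ ∧ power p u = 1})
      (bestConst d m σ p ω) := by
  have hp0 : 0 < p := by linarith
  have hq0 : 0 < 2 / p := by positivity
  have hq1 : 2 / p < 1 := by rw [div_lt_one hp0]; exact hp
  have hmem : ∀ {v : L2 d m}, v ∈ Sobolev d m σ → MemLp v (ENNReal.ofReal p) volume :=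
    fun hv => memLp_of_mem_sobolev hσ hp hsub hv
  have hAbdd : BddBelow (quad σ ω '' {u : L2 d m | u ∈ Sobolev d m σ ∧ power p u = 1}) :=
    bddBelow_quad_image hω _
  have hS0 : 0 < bestConst d m σ p ω := bestConst_pos hσ hp hsub hω
  have hSle : ∀ v ∈ Sobolev d m σ, bestConst d m σ p ω * power p v ^ (2 / p) ≤ quad σ ω v :=
    fun v hv => bestConst_mul_le hp hω hv
  set S := bestConst d m σ p ω with hS
  -- a minimising sequence
  obtain ⟨r, -, hrlim, hr⟩ := exists_seq_tendsto_sInf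
    (nonempty_quad_image (ω := ω) (d := d) (m := m) hσ hp hsub) hAbdd
  choose U hU' hUr using hr
  have hUmem : ∀ n, U n ∈ Sobolev d m σ := fun n => (hU' n).1
  have hU1 : ∀ n, power p (U n) = 1 := fun n => (hU' n).2
  obtain ⟨R, hR⟩ : ∃ R, ∀ n, quad σ ω (U n) ≤ R := by
    obtain ⟨R, hR⟩ := hrlim.bddAbove_range
    exact ⟨R, fun n => by rw [hUr]; exact hR ⟨n, rfl⟩⟩
  have hR0 : 0 ≤ R := (quad_nonneg hω.le _).trans (hR 0)
  set B : ℝ := Real.sqrt (R * (1 + 1 / ω)) with hB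
  have hUB : ∀ n, ‖U n‖ ≤ B ∧ ‖fracLaplacian (σ / 2) (U n)‖ ≤ B := by
    intro n
    have h1 := hR n
    rw [quad] at h1
    have h3 : 0 ≤ ‖fracLaplacian (σ / 2) (U n)‖ ^ 2 := sq_nonneg _
    have h4 : 0 ≤ ω * ‖U n‖ ^ 2 := by positivity
    have h5 : ‖U n‖ ^ 2 ≤ R * (1 / ω) := by
      rw [mul_one_div, le_div_iff₀ hω]; linarith
    have h6 : 0 ≤ R * (1 / ω) := by positivity
    constructor <;> exact Real.le_sqrt_of_sq_le (by linarith)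
  obtain ⟨a, φ, u, w, hφ, hu0, huw, hlu, hlw⟩ := exists_shifted_weak_limit hσ hp hsub one_pos
    (fun n => isFracLaplacian_of_mem (hUmem n)) (fun n => (hUB n).1) (fun n => (hUB n).2)
    (fun n => by rw [eLpNorm_eq_power hp (hmem (hUmem n)), hU1, Real.one_rpow])
  set V : ℕ → L2 d m := fun n => shiftL (a (φ n)) (U (φ n)) with hV
  set W : ℕ → L2 d m := fun n => shiftL (a (φ n)) (fracLaplacian (σ / 2) (U (φ n))) with hW
  have hVW : ∀ n, IsFracLaplacian (σ / 2) (V n) (W n) := fun n =>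
    (isFracLaplacian_of_mem (hUmem _)).shift _
  have hdiff : ∀ n, IsFracLaplacian (σ / 2) (V n - u) (W n - w) := fun n => (hVW n).sub huw
  have hVB : ∀ n, ‖V n‖ ≤ B := fun n => by
    simp only [hV]; rw [LinearIsometry.norm_map]; exact (hUB _).1
  have hWB : ∀ n, ‖W n‖ ≤ B := fun n => by
    simp only [hW]; rw [LinearIsometry.norm_map]; exact (hUB _).2
  obtain ⟨ψ, hψ, hae⟩ := exists_subseq_ae_tendsto_zero hσ hdiff (B := B + max ‖u‖ ‖w‖)
    (fun n => (norm_sub_le _ _).trans (add_le_add (hVB n) (le_max_left _ _)))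
    (fun n => (norm_sub_le _ _).trans (add_le_add (hWB n) (le_max_right _ _)))
    (fun f => by
      have := (hlu f).sub_const (f u)
      rw [sub_self] at this
      refine this.congr fun n => ?_
      rw [map_sub])
  have humem : u ∈ Sobolev d m σ := huw.mem_sobolev
  -- splitting of the quadratic form
  have hquad : Tendsto (fun n => quad σ ω (V (ψ n)) - quad σ ω (V (ψ n) - u)) atTop
      (𝓝 (quad σ ω u)) := by
    have h1 := (tendsto_norm_sq_sub hlw).add ((tendsto_norm_sq_sub hlu).const_mul ω)
    have h2 := h1.comp hψ.tendsto_atTop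
    rw [quad, huw.fracLaplacian_eq]
    refine h2.congr fun n => ?_
    simp only [Function.comp_apply]
    rw [quad, quad, (hVW (ψ n)).fracLaplacian_eq, (hdiff (ψ n)).fracLaplacian_eq]
    ring
  have hVS : Tendsto (fun n => quad σ ω (V (ψ n))) atTop (𝓝 S) := by
    refine ((hrlim.comp hφ.tendsto_atTop).comp hψ.tendsto_atTop).congr fun n => ?_
    simp only [Function.comp_apply, hV]
    rw [quad_shiftL _ (hUmem _), hUr]
  have hrem : Tendsto (fun n => quad σ ω (V (ψ n) - u)) atTop (𝓝 (S - quad σ ω u)) := by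
    refine (hVS.sub hquad).congr fun n => ?_
    ring
  have hV1 : ∀ n, power p (V n) = 1 := fun n => by
    simp only [hV]; rw [power_shiftL, hU1]
  have hapos : 0 < power p u := power_pos hp (hmem humem) hu0
  have huS : quad σ ω u ≤ S := by
    have := ge_of_tendsto' hrem (fun n => quad_nonneg hω.le _)
    linarith
  have hSu := hSle u humem
  have ha1 : power p u ≤ 1 := by
    have h1 : S * power p u ^ (2 / p) ≤ S * 1 := by linarith
    have h2 := le_of_mul_le_mul_left h1 hS0
    by_contra! hcon
    exact absurd h2 (not_le.mpr (Real.one_lt_rpow hcon hq0))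
  have ha : power p u = 1 := by
    by_contra hne
    have hlt : power p u < 1 := lt_of_le_of_ne ha1 hne
    set b := 1 - power p u with hb
    have hb0 : 0 < b := by linarith
    -- an `L^p` bound on the remainder
    obtain ⟨M, hM⟩ : ∃ M, ∀ n, power p (V (ψ n) - u) ≤ M := by
      obtain ⟨C, hC0, hC⟩ := exists_power_le_quad d m hσ hp hsub hω
      obtain ⟨K, hK⟩ := hrem.bddAbove_range
      refine ⟨(C * K) ^ (p / 2), fun n => ?_⟩
      have h1 := (hC _ (hdiff (ψ n)).mem_sobolev).trans
        (mul_le_mul_of_nonneg_left (hK ⟨n, rfl⟩) hC0.le)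
      have h2 := Real.rpow_le_rpow (Real.rpow_nonneg (power_nonneg p _) _) h1
        (show 0 ≤ p / 2 by positivity)
      rw [← Real.rpow_mul (power_nonneg p _)] at h2
      have h3 : 2 / p * (p / 2) = 1 := by field_simp
      rwa [h3, Real.rpow_one] at h2
    have hBL : ∀ η : ℝ, 0 < η → ∀ᶠ n in atTop, b - η ≤ power p (V (ψ n) - u) := by
      intro η hη
      have h1 := eventually_integral_rpow_le (μ := volume) (p := p) (M := M) (by linarith)
        (W := fun n => ((V (ψ n) - u : L2 d m) : Domain d m → ℂ)) (f := u)
        (fun n => Lp.aestronglyMeasurable _) (Lp.aestronglyMeasurable _)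
        (fun n => integrable_rpow_norm hp (hmem (hdiff (ψ n)).mem_sobolev))
        (integrable_rpow_norm hp (hmem humem)) hM hae hη
      filter_upwards [h1] with n hn
      have h2 : ∫ z, ‖(V (ψ n) - u : L2 d m) z + u z‖ ^ p = power p (V (ψ n)) := by
        refine integral_congr_ae ?_
        filter_upwards [Lp.coeFn_sub (V (ψ n)) u] with z hz
        rw [hz, Pi.sub_apply, sub_add_cancel]
      rw [h2, hV1] at hn
      change 1 ≤ power p (V (ψ n) - u) + power p u + η at hn
      linarith
    have hbS : S * b ^ (2 / p) ≤ S - quad σ ω u := by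
      have h1 : ∀ η : ℝ, 0 < η → η < b → S * (b - η) ^ (2 / p) ≤ S - quad σ ω u := by
        intro η hη hηb
        refine ge_of_tendsto hrem ?_
        filter_upwards [hBL η hη] with n hn
        refine le_trans ?_ (hSle _ (hdiff (ψ n)).mem_sobolev)
        have : 0 ≤ b - η := by linarith
        gcongr
      have h2 : Tendsto (fun η : ℝ => S * (b - η) ^ (2 / p)) (𝓝[>] 0)
          (𝓝 (S * (b - 0) ^ (2 / p))) :=
        ((((continuous_const.sub continuous_id).tendsto 0).mono_left
          nhdsWithin_le_nhds).rpow_const (Or.inr hq0.le)).const_mul S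
      rw [sub_zero] at h2
      refine le_of_tendsto h2 ?_
      filter_upwards [Ioo_mem_nhdsGT hb0] with η hη
      exact h1 η hη.1 hη.2
    have h3 : power p u < power p u ^ (2 / p) := by
      have := Real.rpow_lt_rpow_of_exponent_gt hapos hlt hq1
      rwa [Real.rpow_one] at this
    have h4 : b ≤ b ^ (2 / p) := by
      have := Real.rpow_le_rpow_of_exponent_ge hb0 (by linarith) hq1.le
      rwa [Real.rpow_one] at this
    nlinarith
  have hSq : quad σ ω u = S := by
    rw [ha, Real.one_rpow, mul_one] at hSu
    exact le_antisymm huS hSu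
  exact ⟨⟨u, ⟨humem, ha⟩, hSq⟩, fun r hr => csInf_le hAbdd hr⟩

end BestConst

/-! ### The action and its derivatives -/

section Action

variable {σ α ω : ℝ} {u v : L2 d m}

theorem action_eq (σ α ω : ℝ) (u : L2 d m) :
    action σ α ω u = 1 / 2 * quad σ ω u - 1 / (α + 2) * power (α + 2) u := by
  rw [action, quad, power]
  ring

/-- The Nehari functional, from the homogeneity of the two terms of the action along `(1 + t) u`. -/
theorem nehari_eq (hα : 0 < α) (hu : u ∈ Sobolev d m σ) :
    nehari σ α ω u = quad σ ω u - power (α + 2) u := by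
  have e : (fun t : ℝ => action σ α ω (u + (t : ℂ) • u)) = fun t : ℝ =>
      1 / 2 * ((1 + t) ^ 2 * quad σ ω u) - 1 / (α + 2) * (|1 + t| ^ (α + 2) * power (α + 2) u) := by
    ext t
    have e1 : u + (t : ℂ) • u = ((1 + t : ℝ) : ℂ) • u := by
      rw [Complex.ofReal_add, add_smul, Complex.ofReal_one, one_smul]
    rw [e1, action_eq, quad_smul _ hu, power_smul, Complex.norm_real, Real.norm_eq_abs, sq_abs]
  have h1 : HasDerivAt (fun t : ℝ => 1 + t) 1 0 := (hasDerivAt_id 0).const_add 1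
  have h2 : HasDerivAt (fun t : ℝ => |1 + t| ^ (α + 2)) (α + 2) 0 := by
    have h3 := hasDerivAt_abs_rpow (1 + 0) (p := α + 2) (by linarith)
    have := h3.comp (0 : ℝ) h1
    simpa [Function.comp_def] using this
  have h4 : HasDerivAt (fun t : ℝ => (1 + t) ^ 2) 2 0 := by
    simpa using h1.fun_pow 2
  have h5 := ((h4.mul_const (quad σ ω u)).const_mul (1 / 2)).sub
    ((h2.mul_const (power (α + 2) u)).const_mul (1 / (α + 2)))
  rw [nehari, actionDeriv, e]
  refine h5.deriv.trans ?_
  have : α + 2 ≠ 0 := by linarith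
  field_simp

theorem reducedAction_eq (hα : 0 < α) (hu : u ∈ Sobolev d m σ) :
    reducedAction σ α ω u = (1 / 2 - 1 / (α + 2)) * quad σ ω u := by
  rw [reducedAction, action_eq, nehari_eq hα hu]
  ring

theorem integrable_nonlinearity (hα : 0 < α) (hu : MemLp u (ENNReal.ofReal (α + 2)) volume)
    (hv : MemLp v (ENNReal.ofReal (α + 2)) volume) :
    Integrable (fun z => ((‖u z‖ ^ α : ℝ) : ℂ) * u z * (starRingEnd ℂ) (v z)) := by
  refine Integrable.mono' ((integrable_rpow_norm (by linarith) hu).add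
    (integrable_rpow_norm (by linarith) hv)) ?_ (Eventually.of_forall fun z => ?_)
  · refine AEStronglyMeasurable.mul (AEStronglyMeasurable.mul ?_ hu.1)
      (Complex.continuous_conj.comp_aestronglyMeasurable hv.1)
    exact Complex.continuous_ofReal.comp_aestronglyMeasurable
      (hu.1.norm.aemeasurable.pow_const α).aestronglyMeasurable
  · rw [norm_mul, norm_mul, Complex.norm_real, Real.norm_of_nonneg (by positivity),
      RCLike.norm_conj, Pi.add_apply]
    set a := ‖u z‖
    set b := ‖v z‖
    have ha : 0 ≤ a := norm_nonneg _
    have hb : 0 ≤ b := norm_nonneg _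
    have key : ∀ c : ℝ, 0 ≤ c → c ^ (α + 2) = c ^ α * c * c := by
      intro c hc
      rw [Real.rpow_add_of_nonneg hc hα.le (by norm_num), Real.rpow_two]
      ring
    rw [key a ha, key b hb]
    have h1 : 0 ≤ a ^ α * a * a := by positivity
    have h2 : 0 ≤ b ^ α * b * b := by positivity
    rcases le_total a b with h | h
    · have : a ^ α * a * b ≤ b ^ α * b * b := by gcongr
      linarith
    · have : a ^ α * a * b ≤ a ^ α * a * a := by gcongr
      linarith

/-- The directional derivative of `‖u‖_p^p`, by differentiation under the integral sign with the
majorant `p (|u| + |v|)^p`. -/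
theorem hasDerivAt_power (hα : 0 < α) (hu : MemLp u (ENNReal.ofReal (α + 2)) volume)
    (hv : MemLp v (ENNReal.ofReal (α + 2)) volume) :
    HasDerivAt (fun t : ℝ => power (α + 2) (u + (t : ℂ) • v))
      ((α + 2) * (∫ z, ((‖u z‖ ^ α : ℝ) : ℂ) * u z * (starRingEnd ℂ) (v z)).re) 0 := by
  set p := α + 2 with hp
  have hp2 : 2 < p := by linarith
  have e : (fun t : ℝ => power p (u + (t : ℂ) • v)) =
      fun t : ℝ => ∫ z, ‖u z + (t : ℂ) * v z‖ ^ p := by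
    ext t
    refine integral_congr_ae ?_
    filter_upwards [Lp.coeFn_add u ((t : ℂ) • v), Lp.coeFn_smul (t : ℂ) v] with z h1 h2
    rw [h1, Pi.add_apply, h2, Pi.smul_apply, smul_eq_mul]
  set F' : ℝ → Domain d m → ℝ := fun t z =>
    p * ‖u z + (t : ℂ) * v z‖ ^ α * ⟪u z + (t : ℂ) * v z, v z⟫_ℝ with hF'
  have hum : AEStronglyMeasurable u volume := hu.1
  have hvm : AEStronglyMeasurable v volume := hv.1
  have hmeas : ∀ t : ℝ, AEStronglyMeasurable (fun z => u z + (t : ℂ) * v z) volume := fun t =>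
    hum.add (hvm.const_mul _)
  have hsum : MemLp (fun z => ‖u z‖ + ‖v z‖) (ENNReal.ofReal p) volume := hu.norm.add hv.norm
  have hbi : Integrable (fun z => p * (‖u z‖ + ‖v z‖) ^ p) := by
    have h1 := hsum.integrable_norm_rpow (by simpa using by linarith) ENNReal.ofReal_ne_top
    rw [ENNReal.toReal_ofReal (by linarith)] at h1
    refine (h1.const_mul p).congr (Eventually.of_forall fun z => ?_)
    simp only
    rw [Real.norm_of_nonneg (by positivity)]
  have hder := hasDerivAt_integral_of_dominated_loc_of_deriv_le (μ := volume)
    (F := fun (t : ℝ) z => ‖u z + (t : ℂ) * v z‖ ^ p) (F' := F') (x₀ := 0)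
    (s := Metric.ball 0 1) (bound := fun z => p * (‖u z‖ + ‖v z‖) ^ p)
    (Metric.ball_mem_nhds 0 one_pos)
    (Eventually.of_forall fun t =>
      ((hmeas t).norm.aemeasurable.pow_const p).aestronglyMeasurable)
    (by simpa using integrable_rpow_norm hp2 hu)
    ((((hmeas 0).norm.aemeasurable.pow_const α).const_mul p).aestronglyMeasurable.mul
      ((hmeas 0).inner hvm))
    (Eventually.of_forall fun z t ht => by
      have ht1 : |t| ≤ 1 := by simpa using (mem_ball_zero_iff.mp ht).le
      have h1 : ‖u z + (t : ℂ) * v z‖ ≤ ‖u z‖ + ‖v z‖ := by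
        refine (norm_add_le _ _).trans ?_
        rw [norm_mul, Complex.norm_real, Real.norm_eq_abs]
        gcongr
        exact mul_le_of_le_one_left (norm_nonneg _) ht1
      rw [hF', norm_mul, Real.norm_of_nonneg (by positivity)]
      have h2 : ‖⟪u z + (t : ℂ) * v z, v z⟫_ℝ‖ ≤ (‖u z‖ + ‖v z‖) * (‖u z‖ + ‖v z‖) := by
        refine (norm_inner_le_norm _ _).trans ?_
        have := norm_nonneg (u z)
        gcongr
        linarith
      have h3 : (‖u z‖ + ‖v z‖) ^ p =
          (‖u z‖ + ‖v z‖) ^ α * ((‖u z‖ + ‖v z‖) * (‖u z‖ + ‖v z‖)) := by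
        rw [hp, Real.rpow_add_of_nonneg (by positivity) hα.le (by norm_num), Real.rpow_two, sq]
      rw [h3, ← mul_assoc p]
      gcongr)
    hbi
    (Eventually.of_forall fun z t _ => by
      have h1 := hasFDerivAt_norm_rpow (u z + (t : ℂ) * v z) (p := p) (by linarith)
      have h2 : HasDerivAt (fun t : ℝ => u z + (t : ℂ) * v z) (v z) t := by
        have := (Complex.ofRealCLM.hasDerivAt (x := t)).mul_const (v z)
        simpa using this.const_add (u z)
      have h3 := h1.comp_hasDerivAt t h2
      have h4 : p - 2 = α := by rw [hp]; ring
      rw [h4] at h3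
      exact h3)
  rw [e]
  convert! hder.2 using 1
  have h5 : (∫ z, ((‖u z‖ ^ α : ℝ) : ℂ) * u z * (starRingEnd ℂ) (v z)).re =
      ∫ z, (((‖u z‖ ^ α : ℝ) : ℂ) * u z * (starRingEnd ℂ) (v z)).re :=
    (integral_re (integrable_nonlinearity hα hu hv)).symm
  rw [h5, ← integral_const_mul]
  congr 1
  ext z
  simp only [hF', Complex.ofReal_zero, zero_mul, add_zero, Complex.inner]
  rw [mul_assoc ((‖u z‖ ^ α : ℝ) : ℂ), Complex.re_ofReal_mul, mul_assoc]
  congr 2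
  simp only [Complex.mul_re, Complex.conj_re, Complex.conj_im]
  ring

theorem quad_add_smul (hu : u ∈ Sobolev d m σ) (hv : v ∈ Sobolev d m σ) (t : ℝ) :
    quad σ ω (u + (t : ℂ) • v) = quad σ ω u +
      2 * t * (⟪fracLaplacian (σ / 2) v, fracLaplacian (σ / 2) u⟫_ℂ + (ω : ℂ) * ⟪v, u⟫_ℂ).re +
      t ^ 2 * quad σ ω v := by
  have key : ∀ a b : L2 d m, ‖a + (t : ℂ) • b‖ ^ 2 =
      ‖a‖ ^ 2 + 2 * t * (⟪b, a⟫_ℂ).re + t ^ 2 * ‖b‖ ^ 2 := by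
    intro a b
    rw [@norm_add_sq ℂ, inner_smul_right, norm_smul, Complex.norm_real, mul_pow, Real.norm_eq_abs,
      sq_abs, ← inner_conj_symm a b]
    simp only [RCLike.re_to_complex, Complex.re_ofReal_mul, Complex.conj_re]
    ring
  rw [quad, fracLaplacian_add hu (smul_mem_sobolev _ hv), fracLaplacian_smul _ hv, key, key, quad,
    quad, Complex.add_re, Complex.re_ofReal_mul]
  ring

/-- The Euler–Lagrange equation: an extremiser of the Sobolev quotient, scaled so that
`quad = power`, is a weak solution. -/
theorem isWeakSolution_of_extremal {S : ℝ} (hα : 0 < α)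
    (hmem : ∀ {w : L2 d m}, w ∈ Sobolev d m σ → MemLp w (ENNReal.ofReal (α + 2)) volume)
    (hS : ∀ w ∈ Sobolev d m σ, S * power (α + 2) w ^ (2 / (α + 2)) ≤ quad σ ω w)
    (hu : u ∈ Sobolev d m σ) (hpos : 0 < power (α + 2) u)
    (heq : S * power (α + 2) u ^ (2 / (α + 2)) = power (α + 2) u)
    (hquad : quad σ ω u = power (α + 2) u) : IsWeakSolution σ α ω u := by
  have hre : ∀ v ∈ Sobolev d m σ,
      (⟪fracLaplacian (σ / 2) v, fracLaplacian (σ / 2) u⟫_ℂ + (ω : ℂ) * ⟪v, u⟫_ℂ).re =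
        (∫ z, ((‖u z‖ ^ α : ℝ) : ℂ) * u z * (starRingEnd ℂ) (v z)).re := by
    intro v hv
    set Q := (⟪fracLaplacian (σ / 2) v, fracLaplacian (σ / 2) u⟫_ℂ + (ω : ℂ) * ⟪v, u⟫_ℂ).re
    set I := (∫ z, ((‖u z‖ ^ α : ℝ) : ℂ) * u z * (starRingEnd ℂ) (v z)).re
    have h0 : u + ((0 : ℝ) : ℂ) • v = u := by simp
    have hd1 : HasDerivAt (fun t : ℝ => quad σ ω (u + (t : ℂ) • v)) (2 * Q) 0 := by
      have e : (fun t : ℝ => quad σ ω (u + (t : ℂ) • v)) =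
          fun t : ℝ => quad σ ω u + 2 * t * Q + t ^ 2 * quad σ ω v := by
        ext t; exact quad_add_smul hu hv t
      rw [e]
      have h1 : HasDerivAt (fun t : ℝ => 2 * t * Q) (2 * 1 * Q) 0 :=
        ((hasDerivAt_id (0 : ℝ)).const_mul 2).mul_const Q
      have h2 : HasDerivAt (fun t : ℝ => t ^ 2 * quad σ ω v) 0 0 := by
        simpa using (hasDerivAt_pow 2 (0 : ℝ)).mul_const (quad σ ω v)
      simpa using (h1.const_add (quad σ ω u)).fun_add h2
    have hd2 := (hasDerivAt_power hα (hmem hu) (hmem hv)).rpow_const (p := 2 / (α + 2))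
      (Or.inl (by rw [h0]; exact hpos.ne'))
    have hd := hd1.sub (hd2.const_mul S)
    -- `t ↦ Q(u + tv) - S ‖u + tv‖_p²` is nonnegative and vanishes at `t = 0`
    have hmin : IsLocalMin ((fun t : ℝ => quad σ ω (u + (t : ℂ) • v)) -
        fun t : ℝ => S * power (α + 2) (u + (t : ℂ) • v) ^ (2 / (α + 2))) 0 := by
      refine Eventually.of_forall fun t => ?_
      simp only [Pi.sub_apply]
      rw [h0, heq, hquad, sub_self, sub_nonneg]
      exact hS _ (add_mem_sobolev hu (smul_mem_sobolev _ hv))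
    have h3 := hmin.hasDerivAt_eq_zero hd
    rw [h0] at h3
    have h4 : S * power (α + 2) u ^ (2 / (α + 2) - 1) = 1 := by
      rw [Real.rpow_sub hpos, Real.rpow_one, ← mul_div_assoc, heq, div_self hpos.ne']
    have h5 : α + 2 ≠ 0 := by linarith
    have h6 : S * ((α + 2) * I * (2 / (α + 2)) * power (α + 2) u ^ (2 / (α + 2) - 1)) = 2 * I := by
      calc _ = (S * power (α + 2) u ^ (2 / (α + 2) - 1)) * (2 * I) := by field_simp
        _ = _ := by rw [h4, one_mul]
    linarith
  refine ⟨hu, fun v hv => ⟨integrable_nonlinearity hα (hmem hu) (hmem hv), ?_⟩⟩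
  refine Complex.ext (hre v hv) ?_
  -- the imaginary part is the real part for the test function `i v`
  have h1 := hre (Complex.I • v) (smul_mem_sobolev _ hv)
  have h2 : ∫ z, ((‖u z‖ ^ α : ℝ) : ℂ) * u z * (starRingEnd ℂ) ((Complex.I • v : L2 d m) z) =
      -Complex.I * ∫ z, ((‖u z‖ ^ α : ℝ) : ℂ) * u z * (starRingEnd ℂ) (v z) := by
    rw [← integral_const_mul]
    refine integral_congr_ae ?_
    filter_upwards [Lp.coeFn_smul Complex.I v] with z hz
    rw [hz, Pi.smul_apply, smul_eq_mul, map_mul, Complex.conj_I]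
    ring
  rw [h2, fracLaplacian_smul _ hv, inner_smul_left, inner_smul_left, Complex.conj_I,
    mul_left_comm, ← mul_add] at h1
  simpa using h1

/-- Testing the equation with the solution itself: weak solutions lie on the Nehari manifold. -/
theorem IsWeakSolution.quad_eq_power (hα : 0 < α) (h : IsWeakSolution σ α ω u) :
    quad σ ω u = power (α + 2) u := by
  have h1 := (h.2 u h.1).2
  have h2 : ∫ z, ((‖u z‖ ^ α : ℝ) : ℂ) * u z * (starRingEnd ℂ) (u z) =
      ((power (α + 2) u : ℝ) : ℂ) := by
    rw [power, ← integral_complex_ofReal]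
    congr 1
    ext z
    rw [mul_assoc, Complex.mul_conj', Real.rpow_add_of_nonneg (norm_nonneg _) hα.le (by norm_num),
      Real.rpow_two]
    push_cast
    ring
  rw [h2, inner_self_eq_norm_sq_to_K, inner_self_eq_norm_sq_to_K] at h1
  have h3 : ((quad σ ω u : ℝ) : ℂ) = ((power (α + 2) u : ℝ) : ℂ) := by
    rw [← h1, quad]
    push_cast
    rfl
  exact_mod_cast h3

end Action

/-! ### The ground state level -/

section Level

variable {σ α ω : ℝ}

theorem subcritical_of_lt_criticalExponent (hd : 1 ≤ d) (hm : 1 ≤ m) (hσ1 : σ < 1)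
    (hα0 : 0 < α) (hα : (α : EReal) < criticalExponent d m σ) :
    ((d : ℝ) + m) / 2 * (1 - 2 / (α + 2)) < σ := by
  have hd' : (1 : ℝ) ≤ d := by exact_mod_cast hd
  have hm' : (1 : ℝ) ≤ m := by exact_mod_cast hm
  have hD : 2 * σ < (d : ℝ) + m := by linarith
  rw [criticalExponent, if_pos hD, EReal.coe_lt_coe_iff, lt_div_iff₀ (by linarith)] at hα
  have e : ((d : ℝ) + m) / 2 * (1 - 2 / (α + 2)) = ((d : ℝ) + m) * α / (2 * (α + 2)) := by
    have : α + 2 ≠ 0 := by linarith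
    field_simp
    ring
  rw [e, div_lt_iff₀ (by linarith)]
  nlinarith

/-- The level `c_ω`, expressed through the best constant in the Sobolev inequality. -/
def level (d m : ℕ) (σ α ω : ℝ) : ℝ :=
  (1 / 2 - 1 / (α + 2)) * bestConst d m σ (α + 2) ω ^ ((α + 2) / α)

theorem level_coeff_pos (hα : 0 < α) : 0 < 1 / 2 - 1 / (α + 2) := by
  rw [sub_pos]
  exact one_div_lt_one_div_of_lt (by norm_num) (by linarith)

/-- On `ℬ_ω ≤ 0` the quadratic form is bounded below by the level of the extremisers. -/
theorem bestConst_rpow_le_quad (hσ : 0 < σ) (hα : 0 < α)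
    (hsub : ((d : ℝ) + m) / 2 * (1 - 2 / (α + 2)) < σ) (hω : 0 < ω) {u : L2 d m}
    (hu : u ∈ Sobolev d m σ) (hu0 : u ≠ 0) (h : quad σ ω u ≤ power (α + 2) u) :
    bestConst d m σ (α + 2) ω ^ ((α + 2) / α) ≤ quad σ ω u := by
  have hp : 2 < α + 2 := by linarith
  have hQ : 0 < quad σ ω u := quad_pos hω hu0
  have hS := bestConst_pos hσ hp hsub hω
  have h1 : bestConst d m σ (α + 2) ω * quad σ ω u ^ (2 / (α + 2)) ≤ quad σ ω u :=
    (mul_le_mul_of_nonneg_left (Real.rpow_le_rpow hQ.le h (by positivity)) hS.le).trans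
      (bestConst_mul_le hp hω hu)
  have h2 : bestConst d m σ (α + 2) ω ≤ quad σ ω u ^ (1 - 2 / (α + 2)) := by
    rw [Real.rpow_sub hQ, Real.rpow_one, le_div_iff₀ (by positivity)]
    exact h1
  refine (Real.rpow_le_rpow hS.le h2 (by positivity)).trans (le_of_eq ?_)
  rw [← Real.rpow_mul hQ.le]
  have : (1 - 2 / (α + 2)) * ((α + 2) / α) = 1 := by field_simp; ring
  rw [this, Real.rpow_one]

/-- The extremiser of the Sobolev inequality, scaled to the Nehari manifold. -/
theorem exists_extremal (hσ : 0 < σ) (hα : 0 < α)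
    (hsub : ((d : ℝ) + m) / 2 * (1 - 2 / (α + 2)) < σ) (hω : 0 < ω) :
    ∃ φ ∈ Sobolev d m σ, φ ≠ 0 ∧
      quad σ ω φ = bestConst d m σ (α + 2) ω ^ ((α + 2) / α) ∧
      power (α + 2) φ = bestConst d m σ (α + 2) ω ^ ((α + 2) / α) := by
  have hp : 2 < α + 2 := by linarith
  have hS := bestConst_pos hσ hp hsub hω
  obtain ⟨⟨u, ⟨hu, hu1⟩, huS⟩, -⟩ := isLeast_bestConst hσ hp hsub hω
  set S := bestConst d m σ (α + 2) ω with hSdef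
  have hu1' : power (α + 2) u = 1 := hu1
  have hc : 0 < S ^ (1 / α) := by positivity
  refine ⟨((S ^ (1 / α) : ℝ) : ℂ) • u, smul_mem_sobolev _ hu, ?_, ?_, ?_⟩
  · refine smul_ne_zero (by exact_mod_cast hc.ne') ?_
    rintro rfl
    have h0 : power (α + 2) ((0 : ℂ) • (0 : L2 d m)) = 0 := by
      rw [power_smul, norm_zero, Real.zero_rpow (by linarith), zero_mul]
    rw [smul_zero, hu1'] at h0
    exact one_ne_zero h0
  · rw [quad_smul _ hu, huS, Complex.norm_real, Real.norm_of_nonneg hc.le, ← Real.rpow_natCast,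
      ← Real.rpow_mul hS.le]
    nth_rewrite 2 [← Real.rpow_one S]
    rw [← Real.rpow_add hS]
    congr 1
    push_cast
    field_simp
    ring
  · rw [power_smul, hu1', mul_one, Complex.norm_real, Real.norm_of_nonneg hc.le,
      ← Real.rpow_mul hS.le]
    congr 1
    field_simp

/-- The best constant is an attained infimum of functions that are affine in `ω`. -/
theorem concaveOn_bestConst (hσ : 0 < σ) {p : ℝ} (hp : 2 < p)
    (hsub : ((d : ℝ) + m) / 2 * (1 - 2 / p) < σ) :
    ConcaveOn ℝ (Ioi 0) (bestConst d m σ p) := by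
  refine ⟨convex_Ioi 0, fun x hx y hy a b ha hb hab => ?_⟩
  have hxy : 0 < a • x + b • y := (convex_Ioi (0 : ℝ)) hx hy ha hb hab
  obtain ⟨⟨u, hu, huS⟩, -⟩ := isLeast_bestConst (d := d) (m := m) hσ hp hsub hxy
  have h1 := (isLeast_bestConst (d := d) (m := m) hσ hp hsub hx).2 ⟨u, hu, rfl⟩
  have h2 := (isLeast_bestConst (d := d) (m := m) hσ hp hsub hy).2 ⟨u, hu, rfl⟩
  rw [← huS]
  have e : quad σ (a • x + b • y) u = a • quad σ x u + b • quad σ y u := by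
    simp only [quad, smul_eq_mul]
    linear_combination -‖fracLaplacian (σ / 2) u‖ ^ 2 * hab
  rw [e]
  simp only [smul_eq_mul]
  gcongr

theorem strictMonoOn_bestConst (hσ : 0 < σ) {p : ℝ} (hp : 2 < p)
    (hsub : ((d : ℝ) + m) / 2 * (1 - 2 / p) < σ) :
    StrictMonoOn (bestConst d m σ p) (Ioi 0) := by
  intro x hx y hy hxy
  obtain ⟨⟨u, hu, huS⟩, -⟩ := isLeast_bestConst (d := d) (m := m) hσ hp hsub hy
  refine ((isLeast_bestConst (d := d) (m := m) hσ hp hsub hx).2 ⟨u, hu, rfl⟩).trans_lt ?_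
  rw [← huS, quad, quad]
  have hu0 : 0 < ‖u‖ := by
    rw [norm_pos_iff]
    rintro rfl
    have h0 : power p ((0 : ℂ) • (0 : L2 d m)) = 0 := by
      rw [power_smul, norm_zero, Real.zero_rpow (by linarith), zero_mul]
    rw [smul_zero, hu.2] at h0
    exact one_ne_zero h0
  gcongr

end Level

section GroundState

variable {σ α ω : ℝ}

/-- The level is the least action on the Nehari manifold, and it is attained by a weak solution. -/
theorem exists_weakSolution_action_eq_level (hσ : 0 < σ) (hα : 0 < α)
    (hsub : ((d : ℝ) + m) / 2 * (1 - 2 / (α + 2)) < σ) (hω : 0 < ω) :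
    ∃ φ ∈ nehariManifold d m σ α ω, action σ α ω φ = level d m σ α ω ∧
      IsWeakSolution σ α ω φ := by
  obtain ⟨φ, hφ, hφ0, hq, hP⟩ := exists_extremal hσ hα hsub hω
  have hp : 2 < α + 2 := by linarith
  have hS := bestConst_pos hσ hp hsub hω
  refine ⟨φ, ⟨hφ, hφ0, ?_⟩, ?_, ?_⟩
  · rw [nehari_eq hα hφ, hq, hP, sub_self]
  · rw [action_eq, hq, hP, level]
    ring
  · refine isWeakSolution_of_extremal hα (fun hw => memLp_of_mem_sobolev hσ hp hsub hw)
      (fun w hw => bestConst_mul_le hp hω hw) hφ ?_ ?_ (hq.trans hP.symm)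
    · rw [hP]; positivity
    · rw [hP, ← Real.rpow_mul hS.le]
      nth_rewrite 1 [← Real.rpow_one (bestConst d m σ (α + 2) ω)]
      rw [← Real.rpow_add hS]
      congr 1
      field_simp

theorem level_le_reducedAction (hσ : 0 < σ) (hα : 0 < α)
    (hsub : ((d : ℝ) + m) / 2 * (1 - 2 / (α + 2)) < σ) (hω : 0 < ω) {u : L2 d m}
    (hu : u ∈ Sobolev d m σ) (hu0 : u ≠ 0) (h : nehari σ α ω u ≤ 0) :
    level d m σ α ω ≤ reducedAction σ α ω u := by
  rw [nehari_eq hα hu, sub_nonpos] at h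
  rw [reducedAction_eq hα hu, level]
  exact mul_le_mul_of_nonneg_left (bestConst_rpow_le_quad hσ hα hsub hω hu hu0 h)
    (level_coeff_pos hα).le

theorem reducedAction_eq_action {u : L2 d m} (h : nehari σ α ω u = 0) :
    reducedAction σ α ω u = action σ α ω u := by
  rw [reducedAction, h, mul_zero, sub_zero]

theorem isLeast_level (hσ : 0 < σ) (hα : 0 < α)
    (hsub : ((d : ℝ) + m) / 2 * (1 - 2 / (α + 2)) < σ) (hω : 0 < ω) :
    IsLeast (action σ α ω '' nehariManifold d m σ α ω) (level d m σ α ω) := by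
  obtain ⟨φ, hφ, hact, -⟩ := exists_weakSolution_action_eq_level hσ hα hsub hω
  refine ⟨⟨φ, hφ, hact⟩, ?_⟩
  rintro _ ⟨u, ⟨hu, hu0, hn⟩, rfl⟩
  rw [← reducedAction_eq_action hn]
  exact level_le_reducedAction hσ hα hsub hω hu hu0 hn.le

theorem groundLevel_eq_level (hσ : 0 < σ) (hα : 0 < α)
    (hsub : ((d : ℝ) + m) / 2 * (1 - 2 / (α + 2)) < σ) (hω : 0 < ω) :
    groundLevel d m σ α ω = level d m σ α ω :=
  (isLeast_level hσ hα hsub hω).csInf_eq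

theorem continuousOn_level (hσ : 0 < σ) (hα : 0 < α)
    (hsub : ((d : ℝ) + m) / 2 * (1 - 2 / (α + 2)) < σ) :
    ContinuousOn (level d m σ α) (Ioi 0) :=
  (((concaveOn_bestConst hσ (by linarith) hsub).continuousOn isOpen_Ioi).rpow_const
    fun _ _ => Or.inr (by positivity)).const_mul _

theorem strictMonoOn_level (hσ : 0 < σ) (hα : 0 < α)
    (hsub : ((d : ℝ) + m) / 2 * (1 - 2 / (α + 2)) < σ) :
    StrictMonoOn (level d m σ α) (Ioi 0) := fun _ hx _ hy hxy =>
  mul_lt_mul_of_pos_left (Real.rpow_lt_rpow (bestConst_pos hσ (by linarith) hsub hx).le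
    (strictMonoOn_bestConst hσ (by linarith) hsub hx hy hxy) (by positivity)) (level_coeff_pos hα)

end GroundState

end Waveguide

end

theorem mainTheorem2 (d m : ℕ) (hd : 1 ≤ d) (hm : 1 ≤ m) (σ α : ℝ)
    (hσ0 : 0 < σ) (hσ1 : σ < 1) (hα0 : 0 < α)
    (hα : (α : EReal) < Waveguide.criticalExponent d m σ) :
    (∀ ω : ℝ, 0 < ω →
      IsGLB (Waveguide.action σ α ω '' Waveguide.nehariManifold d m σ α ω)
        (Waveguide.groundLevel d m σ α ω) ∧
      (∃ φ ∈ Waveguide.nehariManifold d m σ α ω,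
        Waveguide.action σ α ω φ = Waveguide.groundLevel d m σ α ω ∧
        Waveguide.IsGroundState σ α ω φ) ∧
      IsGLB (Waveguide.reducedAction σ α ω ''
          {u : Waveguide.L2 d m |
            u ∈ Waveguide.Sobolev d m σ ∧ u ≠ 0 ∧ Waveguide.nehari σ α ω u ≤ 0})
        (Waveguide.groundLevel d m σ α ω)) ∧
    ContinuousOn (fun ω : ℝ => Waveguide.groundLevel d m σ α ω) (Set.Ioi 0) ∧
    StrictMonoOn (fun ω : ℝ => Waveguide.groundLevel d m σ α ω) (Set.Ioi 0) := by
  have hsub := Waveguide.subcritical_of_lt_criticalExponent hd hm hσ1 hα0 hα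
  have hlevel : ∀ ω ∈ Set.Ioi (0 : ℝ), Waveguide.groundLevel d m σ α ω =
      Waveguide.level d m σ α ω := fun ω hω =>
    Waveguide.groundLevel_eq_level hσ0 hα0 hsub hω
  refine ⟨fun ω hω => ?_, ?_, ?_⟩
  · have hleast := Waveguide.isLeast_level (d := d) (m := m) hσ0 hα0 hsub hω
    rw [hlevel ω hω]
    obtain ⟨φ, hφ, hact, hweak⟩ :=
      Waveguide.exists_weakSolution_action_eq_level (d := d) (m := m) hσ0 hα0 hsub hω
    refine ⟨hleast.isGLB, ⟨φ, hφ, hact, hweak, hφ.2.1, fun ψ hψ hψ0 => ?_⟩, ?_⟩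
    · -- every nontrivial weak solution lies on the Nehari manifold
      rw [hact]
      refine hleast.2 ⟨ψ, ⟨hψ.1, hψ0, ?_⟩, rfl⟩
      rw [Waveguide.nehari_eq hα0 hψ.1, hψ.quad_eq_power hα0, sub_self]
    · refine IsLeast.isGLB ⟨⟨φ, ⟨hφ.1, hφ.2.1, hφ.2.2.le⟩, ?_⟩, ?_⟩
      · rw [Waveguide.reducedAction_eq_action hφ.2.2, hact]
      · rintro _ ⟨u, ⟨hu, hu0, hn⟩, rfl⟩
        exact Waveguide.level_le_reducedAction hσ0 hα0 hsub hω hu hu0 hn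
  · exact (Waveguide.continuousOn_level hσ0 hα0 hsub).congr hlevel
  · exact (Waveguide.strictMonoOn_level hσ0 hα0 hsub).congr fun ω hω => (hlevel ω hω).symm
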